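/- Conventions. A structure $(M,\mathcal X)$ for second-order arithmetic consists of a first-order structure $M$ for the language $0,1,+,\cdot,<$ and a family $\mathcal X\subseteq\mathcal P(M)$. Formulas may contain number parameters from $M$ and set parameters from $\mathcal X$; $\Delta^0_0$ formulas have only bounded number quantifiers, and $\Sigma^0_1$ (resp. $\Pi^0_1$) formulas are those of the form $\exists y\,\varphi$ (resp. $\forall y\,\varphi$) with $\varphi$ a $\Delta^0_0$ formula. The theory $\mathrm{RCA}^*_0$ consists of $\mathrm{PA}^-$ (the axioms of nonnegative parts of discretely ordered commutative rings), $\Delta^0_0$ induction, $\Sigma^0_1$ collection, the axiom $\exp$ ($\forall x\,\exists y\; y=2^x$), and $\Delta^0_1$ comprehension. A cut in $M$ is a subset $I\subseteq M$ that contains $0$ and is closed downwards and under successor; it is proper if $I\neq M$. For $s\in M$ let $(s)_{\mathrm{Ack}}$ be the set of all $a\in M$ such that, in $M$, the $a$-th bit in the binary notation for $s$ is $1$. Tuples are coded by iterating the Cantor pairing function of $M$. For a proper cut $I$, $\mathrm{Cod}(M/I)=\{(s)_{\mathrm{Ack}}\cap I : s\in M\}$; likewise an $m$-ary relation on $I$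 is said to belong to $\mathrm{Cod}(M/I)$ if it has the form $\{(i_1,\dots,i_m)\in I^m : \langle i_1,\dots,i_m\rangle\in (s)_{\mathrm{Ack}}\}$ for some $s\in M$, while an $m$-ary relation on $M$ is said to belong to $\mathcal X$ if the set of codes of its tuples does. For standard $n,k\in\omega$, $\mathrm{RT}^n_k$ is the statement: for every colouring $f\colon[\mathbb N]^n\to k$ (of increasing $n$-tuples) there is an unbounded set $H$ such that $f$ is constant on $[H]^n$. It is interpreted in $(M,\mathcal X)$ by letting $\mathbb N$ be $M$ and letting $f$ (through its graph) and $H$ range over members of $\mathcal X$, and in $(I,\mathrm{Cod}(M/I))$ by letting $\mathbb N$ be $I$ and letting $f$ (through its graph) and $H$ range over members of $\mathrm{Cod}(M/I)$. **Theorem.** Let $(M,\mathcal X)\models\mathrm{RCA}^*_0$ and let $I\subseteq M$ be a proper cut in $M$ that is $\Sigma^0_1$-definable in $(M,\mathcal X)$. Then for all $n,k\in\omega$, $$(M,\mathcal X)\models\mathrm{RT}^n_k\quad\text{if and only if}\quad (I,\mathrm{Cod}(M/I))\models\mathrm{RT}^n_k .$$ -/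

import Mathlib

universe u

namespace Arith

/-! Throughout, the first-order part of a structure is a type `M` with the type classes
`CommSemiring`, `LinearOrder`, `IsStrictOrderedRing` and `CanonicallyOrderedAdd`; together with
discreteness (the field `discrete` of `ModelsRCA0Star`) these are the axioms of `PA⁻`.
The second-order part is a collection `𝒳 : Set (Set M)`. -/

/-- Terms of the language of arithmetic in the variables `x₀, …, xₙ₋₁`, with parameters from `M`
(the constants `0` and `1` are among the parameters). -/
inductive Term (M : Type u) (n : ℕ) : Type u
  | var (i : Fin n) : Term M n
  | const (a : M) : Term M n
  | add (t s : Term M n) : Term M n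
  | mul (t s : Term M n) : Term M n

/-- `Δ⁰₀` (bounded) formulas in the variables `x₀, …, xₙ₋₁`, with number parameters from `M` and
set parameters from `𝒳`. In `ball t φ` and `bex t φ` the bound variable is the variable `x₀` of
`φ`, and the variables of the bounding term `t` are shifted by one in `φ`. -/
inductive Delta00 {M : Type u} (𝒳 : Set (Set M)) : ℕ → Type u
  | eq {n : ℕ} (t s : Term M n) : Delta00 𝒳 n
  | lt {n : ℕ} (t s : Term M n) : Delta00 𝒳 n
  | mem {n : ℕ} (t : Term M n) (X : Set M) (hX : X ∈ 𝒳) : Delta00 𝒳 n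
  | not {n : ℕ} (φ : Delta00 𝒳 n) : Delta00 𝒳 n
  | and {n : ℕ} (φ ψ : Delta00 𝒳 n) : Delta00 𝒳 n
  | or {n : ℕ} (φ ψ : Delta00 𝒳 n) : Delta00 𝒳 n
  | ball {n : ℕ} (t : Term M n) (φ : Delta00 𝒳 (n + 1)) : Delta00 𝒳 n
  | bex {n : ℕ} (t : Term M n) (φ : Delta00 𝒳 (n + 1)) : Delta00 𝒳 n

section Defs

variable {M : Type u} [CommSemiring M] [LinearOrder M]

/-- The value of a term. -/
def Term.eval {n : ℕ} (v : Fin n → M) : Term M n → M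
  | .var i => v i
  | .const a => a
  | .add t s => t.eval v + s.eval v
  | .mul t s => t.eval v * s.eval v

/-- Satisfaction of a `Δ⁰₀` formula in `(M, 𝒳)`. -/
def Delta00.Realize {𝒳 : Set (Set M)} : {n : ℕ} → Delta00 𝒳 n → (Fin n → M) → Prop
  | _, .eq t s, v => t.eval v = s.eval v
  | _, .lt t s, v => t.eval v < s.eval v
  | _, .mem t X _, v => t.eval v ∈ X
  | _, .not φ, v => ¬ φ.Realize v
  | _, .and φ ψ, v => φ.Realize v ∧ ψ.Realize v
  | _, .or φ ψ, v => φ.Realize v ∨ ψ.Realize v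
  | _, .ball t φ, v => ∀ a, a < t.eval v → φ.Realize (Matrix.vecCons a v)
  | _, .bex t φ, v => ∃ a, a < t.eval v ∧ φ.Realize (Matrix.vecCons a v)

/-- `A ⊆ M` is `Σ⁰₁`-definable in `(M, 𝒳)` (with parameters). -/
def Sigma01Definable (𝒳 : Set (Set M)) (A : Set M) : Prop :=
  ∃ φ : Delta00 𝒳 2, A = {x | ∃ y, φ.Realize ![x, y]}

/-- `A ⊆ M` is `Π⁰₁`-definable in `(M, 𝒳)` (with parameters). -/
def Pi01Definable (𝒳 : Set (Set M)) (A : Set M) : Prop :=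
  ∃ φ : Delta00 𝒳 2, A = {x | ∀ y, φ.Realize ![x, y]}

/-- `v = β(a, b, i)` for Gödel's `β` function: `v` is the remainder of `a` modulo
`1 + (i + 1) b`. -/
def IsBeta (a b i v : M) : Prop :=
  v < 1 + (i + 1) * b ∧ ∃ q, a = q * (1 + (i + 1) * b) + v

/-- `y = 2 ^ x` as an arithmetical relation: some sequence coded by the `β` function starts with
`1`, doubles at each step below `x`, and has `x`-th term `y`. -/
def IsPow2 (x y : M) : Prop :=
  ∃ a b, IsBeta a b 0 1 ∧
    (∀ i, i < x → ∃ v, IsBeta a b i v ∧ IsBeta a b (i + 1) (2 * v)) ∧ IsBeta a b x y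

/-- `(M, 𝒳)` is a model of `RCA₀*`: discreteness (completing `PA⁻`), `Δ⁰₀` induction,
`Σ⁰₁` collection, totality of exponentiation, and `Δ⁰₁` comprehension. -/
structure ModelsRCA0Star (𝒳 : Set (Set M)) : Prop where
  discrete : ∀ a : M, 0 < a → 1 ≤ a
  induction : ∀ φ : Delta00 𝒳 1, φ.Realize ![0] →
    (∀ x, φ.Realize ![x] → φ.Realize ![x + 1]) → ∀ x, φ.Realize ![x]
  collection : ∀ (φ : Delta00 𝒳 3) (v : M), (∀ x, x < v → ∃ y z, φ.Realize ![x, y, z]) →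
    ∃ w, ∀ x, x < v → ∃ y, y < w ∧ ∃ z, φ.Realize ![x, y, z]
  exp : ∀ x : M, ∃ y, IsPow2 x y
  comprehension : ∀ A : Set M, Sigma01Definable 𝒳 A → Pi01Definable 𝒳 A → A ∈ 𝒳

/-- A cut: it contains `0` and is closed downwards and under successor. -/
structure IsCut (I : Set M) : Prop where
  zero_mem : 0 ∈ I
  downward : ∀ a b, a ≤ b → b ∈ I → a ∈ I
  succ_mem : ∀ a, a ∈ I → a + 1 ∈ I

/-- Ackermann membership: the `a`-th bit in the binary notation for `s` is `1`. -/
def AckMem (a s : M) : Prop :=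
  ∃ y, IsPow2 a y ∧ ∃ q r, r < y ∧ s = (2 * q + 1) * y + r

/-- `p = ⟨a, b⟩` for the Cantor pairing function `⟨a, b⟩ = (a + b)(a + b + 1) / 2 + b`. -/
def IsPair (a b p : M) : Prop :=
  2 * p = (a + b) * (a + b + 1) + 2 * b

/-- `p` is the code `⟨x₀, ⟨x₁, ⟨…, xₘ₋₁⟩⟩⟩` of the tuple `x`; the code of a one-element tuple
is its element. -/
def IsTupleCode : {m : ℕ} → (Fin m → M) → M → Prop
  | 0, _, p => p = 0
  | 1, x, p => p = x 0
  | _ + 2, x, p => ∃ q, IsTupleCode (Fin.tail x) q ∧ IsPair (x 0) q p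

/-- The `m`-ary relations on `M` that belong to `𝒳` via tuple codes. -/
def relIn (𝒳 : Set (Set M)) (m : ℕ) : Set (Set (Fin m → M)) :=
  {R | {p | ∃ x ∈ R, IsTupleCode x p} ∈ 𝒳}

/-- `Cod(M/I)`: the subsets of `I` coded in `M`. -/
def cod (I : Set M) : Set (Set M) :=
  {A | ∃ s, A = {a | AckMem a s} ∩ I}

/-- `Cod(M/I)` for `m`-ary relations: the relations on `I` coded in `M`. Tuple codes are computed
in `M`, since `I` need not be closed under multiplication. -/
def codRel (I : Set M) (m : ℕ) : Set (Set (Fin m → M)) :=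
  {R | ∃ s, R = {x | (∀ j, x j ∈ I) ∧ ∃ p, IsTupleCode x p ∧ AckMem p s}}

/-- The graph `{(x₁, …, xₙ, f(x₁, …, xₙ)) : x₁ < ⋯ < xₙ in D}` of a colouring `f : [D]ⁿ → k`. -/
def graph {D : Set M} {n k : ℕ} (f : (Fin n ↪o D) → Fin k) : Set (Fin (n + 1) → M) :=
  {t | ∃ x : Fin n ↪o D, t = Fin.snoc (α := fun _ => M) (fun i => (x i : M)) ((f x : ℕ) : M)}

/-- Ramsey's theorem `RTⁿₖ` in the structure with first-order universe `D ⊆ M`, whose sets are the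
members of `𝒮` and whose relations are the members of `ℛ`: every colouring `f : [D]ⁿ → k` in the
structure has an unbounded homogeneous set `H` in the structure. -/
def Ramsey (D : Set M) (𝒮 : Set (Set M)) (ℛ : (m : ℕ) → Set (Set (Fin m → M)))
    (n k : ℕ) : Prop :=
  ∀ f : (Fin n ↪o D) → Fin k, graph f ∈ ℛ (n + 1) →
    ∃ H ∈ 𝒮, H ⊆ D ∧ (∀ a ∈ D, ∃ b ∈ H, a ≤ b) ∧
      ∃ c : Fin k, ∀ x : Fin n ↪o D, (∀ i, (x i : M) ∈ H) → f x = c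

/-- `(M, 𝒳) ⊨ RTⁿₖ`. -/
def ModelRT (𝒳 : Set (Set M)) (n k : ℕ) : Prop :=
  Ramsey Set.univ 𝒳 (relIn 𝒳) n k

/-- `(I, Cod(M/I)) ⊨ RTⁿₖ`. -/
def CutRT (I : Set M) (n k : ℕ) : Prop :=
  Ramsey I (cod I) (codRel I) n k

end Defs

end Arith

/-! The cut `I` and the whole of `M` have the same length. Map `x ∈ I` to `u + x`, where `u` is the
least bound below which every `x' ≤ x` has a witness for its membership in `I`. By collection this
is defined on all of `I`. It is cofinal in `M`, because a common bound on all the witnesses would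
let `Δ⁰₀` induction prove `I = M`. The resulting `G : I → M` is strictly increasing, and `index`,
sending `y` to the least `x` with `y ≤ G x`, goes back from `M` to `I`. Colourings and homogeneous
sets are transported along these two maps (`exists_enumeration`, `modelRT_of_cutRT`,
`cutRT_of_modelRT`).

From `I` to `M`, definability suffices: a set described through `index` and a code is `Δ⁰₀`, hence
in `𝒳`. From `M` to `I`, the transported object is `Σ⁰₁` with a complement on `I` that is also
`Σ⁰₁`. Since `I` lies below some `a ∉ I`, it remains to separate two disjoint `Σ⁰₁` sets below a
bound by a coded set. That is `exists_separation`, which follows from collection over the `2 ^ b`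
candidate codes.

Definability is handled by one device: a `Δ⁰₁` relation belongs to `𝒳` by comprehension, so it may
serve as a set parameter and counts as `Δ⁰₀` (`IsDelta0.of_delta1`). Functions with `Δ⁰₀` graph,
even fast-growing ones such as `pow2`, can then be composed freely and used as bounds of
quantifiers. -/

namespace Arith

/-! ### Functions given by terms -/

section Terms

variable {M : Type u} [CommSemiring M] {n m : ℕ}

/-- Functions given by terms. -/
def TermFn (f : (Fin n → M) → M) : Prop := ∃ t : Term M n, ∀ v, t.eval v = f v

namespace TermFn

theorem proj (i : Fin n) : TermFn fun v : Fin n → M => v i := ⟨.var i, fun _ => rfl⟩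

theorem const (a : M) : TermFn fun _ : Fin n → M => a := ⟨.const a, fun _ => rfl⟩

theorem add {f g : (Fin n → M) → M} : TermFn f → TermFn g → TermFn fun v => f v + g v
  | ⟨t, ht⟩, ⟨s, hs⟩ => ⟨.add t s, fun v => by simp [Term.eval, ht, hs]⟩

theorem mul {f g : (Fin n → M) → M} : TermFn f → TermFn g → TermFn fun v => f v * g v
  | ⟨t, ht⟩, ⟨s, hs⟩ => ⟨.mul t s, fun v => by simp [Term.eval, ht, hs]⟩

theorem rename {f : (Fin n → M) → M} (σ : Fin n → Fin m) :
    TermFn f → TermFn fun v : Fin m → M => f fun i => v (σ i) := by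
  rintro ⟨t, ht⟩
  suffices h : ∀ t : Term M n, ∃ s : Term M m, ∀ v, s.eval v = t.eval fun i => v (σ i) by
    obtain ⟨s, hs⟩ := h t
    exact ⟨s, fun v => by rw [hs, ht]⟩
  intro t
  induction t with
  | var i => exact ⟨.var (σ i), fun _ => rfl⟩
  | const a => exact ⟨.const a, fun _ => rfl⟩
  | add _ _ h₁ h₂ => exact add h₁ h₂
  | mul _ _ h₁ h₂ => exact mul h₁ h₂

end TermFn

end Terms

/-! ### Closure properties of `Δ⁰₀` relations -/

section Definability

variable {M : Type u} [CommSemiring M] [LinearOrder M] {𝒳 : Set (Set M)} {n m : ℕ}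

/-- Relations defined by `Δ⁰₀` formulas with parameters. -/
def IsDelta0 (𝒳 : Set (Set M)) (P : (Fin n → M) → Prop) : Prop :=
  ∃ φ : Delta00 𝒳 n, ∀ v, φ.Realize v ↔ P v

namespace IsDelta0

variable {P Q : (Fin n → M) → Prop}

theorem congr (h : IsDelta0 𝒳 P) (e : ∀ v, Q v ↔ P v) : IsDelta0 𝒳 Q :=
  h.imp fun _ hφ v => (hφ v).trans (e v).symm

theorem not : IsDelta0 𝒳 P → IsDelta0 𝒳 fun v => ¬ P v
  | ⟨φ, hφ⟩ => ⟨.not φ, fun v => by simp [Delta00.Realize, hφ]⟩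

theorem and : IsDelta0 𝒳 P → IsDelta0 𝒳 Q → IsDelta0 𝒳 fun v => P v ∧ Q v
  | ⟨φ, hφ⟩, ⟨ψ, hψ⟩ => ⟨.and φ ψ, fun v => by simp [Delta00.Realize, hφ, hψ]⟩

theorem or : IsDelta0 𝒳 P → IsDelta0 𝒳 Q → IsDelta0 𝒳 fun v => P v ∨ Q v
  | ⟨φ, hφ⟩, ⟨ψ, hψ⟩ => ⟨.or φ ψ, fun v => by simp [Delta00.Realize, hφ, hψ]⟩

theorem imp (hP : IsDelta0 𝒳 P) (hQ : IsDelta0 𝒳 Q) : IsDelta0 𝒳 fun v => P v → Q v :=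
  (hP.not.or hQ).congr fun _ => imp_iff_not_or

theorem iff (hP : IsDelta0 𝒳 P) (hQ : IsDelta0 𝒳 Q) : IsDelta0 𝒳 fun v => (P v ↔ Q v) :=
  ((hP.imp hQ).and (hQ.imp hP)).congr fun _ => iff_iff_implies_and_implies

theorem eq_term {f g : (Fin n → M) → M} :
    TermFn f → TermFn g → IsDelta0 𝒳 fun v => f v = g v
  | ⟨t, ht⟩, ⟨s, hs⟩ => ⟨.eq t s, fun v => by simp [Delta00.Realize, ht, hs]⟩

theorem lt_term {f g : (Fin n → M) → M} :
    TermFn f → TermFn g → IsDelta0 𝒳 fun v => f v < g v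
  | ⟨t, ht⟩, ⟨s, hs⟩ => ⟨.lt t s, fun v => by simp [Delta00.Realize, ht, hs]⟩

theorem le_term {f g : (Fin n → M) → M} (hf : TermFn f) (hg : TermFn g) :
    IsDelta0 𝒳 fun v => f v ≤ g v :=
  (lt_term hg hf).not.congr fun _ => not_lt.symm

theorem mem_term {f : (Fin n → M) → M} {X : Set M} (hX : X ∈ 𝒳) :
    TermFn f → IsDelta0 𝒳 fun v => f v ∈ X
  | ⟨t, ht⟩ => ⟨.mem t X hX, fun v => by simp [Delta00.Realize, ht]⟩

theorem ball_term {f : (Fin n → M) → M} {P : (Fin n → M) → M → Prop} :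
    TermFn f → IsDelta0 𝒳 (fun w : Fin (n + 1) → M => P (fun i => w i.succ) (w 0)) →
      IsDelta0 𝒳 fun v => ∀ a, a < f v → P v a
  | ⟨t, ht⟩, ⟨φ, hφ⟩ => ⟨.ball t φ, fun v => by simp [Delta00.Realize, ht, hφ]⟩

theorem bex_term {f : (Fin n → M) → M} {P : (Fin n → M) → M → Prop} :
    TermFn f → IsDelta0 𝒳 (fun w : Fin (n + 1) → M => P (fun i => w i.succ) (w 0)) →
      IsDelta0 𝒳 fun v => ∃ a, a < f v ∧ P v a
  | ⟨t, ht⟩, ⟨φ, hφ⟩ => ⟨.bex t φ, fun v => by simp [Delta00.Realize, ht, hφ]⟩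

theorem const (p : Prop) : IsDelta0 𝒳 fun _ : Fin n → M => p := by
  have h : IsDelta0 𝒳 fun _ : Fin n → M => (0 : M) = 0 := eq_term (.const 0) (.const 0)
  by_cases hp : p
  · exact h.congr fun _ => by simp [hp]
  · exact h.not.congr fun _ => by simp [hp]

theorem realize_rename (φ : Delta00 𝒳 n) (σ : Fin n → Fin m) :
    IsDelta0 𝒳 fun v : Fin m → M => φ.Realize fun i => v (σ i) := by
  have lift : ∀ {n m : ℕ} (σ : Fin n → Fin m) (w : Fin (m + 1) → M),
      Matrix.vecCons (w 0) (fun i => w (σ i).succ)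
        = fun i => w ((Fin.cons 0 fun i => (σ i).succ : Fin (n + 1) → Fin (m + 1)) i) := by
    intro n m σ w
    funext i
    cases i using Fin.cases <;> rfl
  have term : ∀ {n m : ℕ} (σ : Fin n → Fin m) (t : Term M n),
      TermFn fun v : Fin m → M => t.eval fun i => v (σ i) :=
    fun σ t => TermFn.rename σ ⟨t, fun _ => rfl⟩
  induction φ generalizing m with
  | eq t s => exact eq_term (term σ t) (term σ s)
  | lt t s => exact lt_term (term σ t) (term σ s)
  | mem t X hX => exact mem_term hX (term σ t)
  | not φ h => exact (h σ).not
  | and φ ψ h₁ h₂ => exact (h₁ σ).and (h₂ σ)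
  | or φ ψ h₁ h₂ => exact (h₁ σ).or (h₂ σ)
  | ball t φ h =>
    refine ball_term (term σ t)
      (P := fun v a => φ.Realize (Matrix.vecCons a fun i => v (σ i))) ?_
    exact (h (Fin.cons 0 fun i => (σ i).succ)).congr fun w => by rw [lift σ w]
  | bex t φ h =>
    refine bex_term (term σ t)
      (P := fun v a => φ.Realize (Matrix.vecCons a fun i => v (σ i))) ?_
    exact (h (Fin.cons 0 fun i => (σ i).succ)).congr fun w => by rw [lift σ w]

theorem rename (σ : Fin n → Fin m) :
    IsDelta0 𝒳 P → IsDelta0 𝒳 fun v : Fin m → M => P fun i => v (σ i)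
  | ⟨φ, hφ⟩ => (realize_rename φ σ).congr fun _ => (hφ _).symm

theorem forall_fin {k : ℕ} {R : Fin k → (Fin n → M) → Prop} (h : ∀ i, IsDelta0 𝒳 (R i)) :
    IsDelta0 𝒳 fun v => ∀ i, R i v := by
  induction k with
  | zero => exact (const True).congr fun v => by simp
  | succ k ih => exact ((h 0).and (ih fun i => h i.succ)).congr fun v => Fin.forall_fin_succ

end IsDelta0

end Definability

/-! ### Induction, discreteness and the least number principle -/

section Arithmetic

variable {M : Type u} [CommSemiring M] [LinearOrder M] {𝒳 : Set (Set M)} {n m : ℕ}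

namespace ModelsRCA0Star

variable (hM : ModelsRCA0Star 𝒳)
include hM

theorem induct {P : M → Prop} (hP : IsDelta0 𝒳 fun v : Fin 1 → M => P (v 0))
    (h0 : P 0) (hs : ∀ x, P x → P (x + 1)) (x : M) : P x := by
  obtain ⟨φ, hφ⟩ := hP
  have := hM.induction φ ((hφ _).2 h0) (fun x hx => (hφ _).2 (hs x ((hφ _).1 hx))) x
  exact (hφ _).1 this

variable [CanonicallyOrderedAdd M]

theorem eq_zero_or_exists_add_one (a : M) : a = 0 ∨ ∃ b, a = b + 1 := by
  rcases eq_or_ne a 0 with h | h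
  · exact .inl h
  · obtain ⟨b, rfl⟩ := le_iff_exists_add'.1 (hM.discrete a (pos_iff_ne_zero.2 h))
    exact .inr ⟨b, rfl⟩

variable [IsStrictOrderedRing M]

theorem add_one_le {a b : M} (h : a < b) : a + 1 ≤ b := by
  obtain ⟨c, rfl⟩ := le_iff_exists_add.1 h.le
  exact add_le_add_right (hM.discrete c (by simpa using h)) a

theorem lt_add_one {a b : M} : a < b + 1 ↔ a ≤ b := by
  refine ⟨fun h => ?_, fun h => h.trans_lt (_root_.lt_add_one b)⟩
  by_contra hab
  exact absurd (hM.add_one_le (not_le.1 hab)) (not_le.2 h)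

theorem exists_least {P : M → Prop} (hP : IsDelta0 𝒳 fun v : Fin 1 → M => P (v 0))
    (h : ∃ x, P x) : ∃ x, P x ∧ ∀ y < x, ¬ P y := by
  by_contra! hc
  obtain ⟨x, hx⟩ := h
  have key : ∀ z y, y < z → ¬ P y := by
    refine hM.induct (P := fun z => ∀ y, y < z → ¬ P y)
      (.ball_term (.proj 0) (P := fun _ y => ¬ P y) (hP.rename ![0]).not) ?_ ?_
    · intro y hy
      exact absurd hy not_lt_zero
    · intro z hz y hy hPy
      obtain ⟨w, hw, hPw⟩ := hc y hPy
      exact hz w (hw.trans_le (hM.lt_add_one.1 hy)) hPw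
  exact key (x + 1) x (_root_.lt_add_one x) hx

end ModelsRCA0Star

end Arithmetic

/-! ### Cantor pairing, and the reduction of `Δ⁰₁` to `Δ⁰₀` -/

section Pairing

variable {M : Type u} [CommSemiring M] [LinearOrder M] {𝒳 : Set (Set M)} {n m : ℕ}

/-- The Cantor pairing function. -/
noncomputable def pair (a b : M) : M := Classical.epsilon (IsPair a b)

/-- The first component of a pair. -/
noncomputable def unpairL (p : M) : M := Classical.epsilon fun a => ∃ b, IsPair a b p

/-- The second component of a pair. -/
noncomputable def unpairR (p : M) : M := Classical.epsilon fun b => ∃ a, IsPair a b p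

theorem isDelta0_isPair : IsDelta0 𝒳 fun v : Fin 3 → M => IsPair (v 0) (v 1) (v 2) :=
  .eq_term (.mul (.const 2) (.proj 2))
    (.add (.mul (.add (.proj 0) (.proj 1)) (.add (.add (.proj 0) (.proj 1)) (.const 1)))
      (.mul (.const 2) (.proj 1)))

variable [IsStrictOrderedRing M]

theorem two_mul_cancel {a b : M} (h : 2 * a = 2 * b) : a = b := by grind

variable [CanonicallyOrderedAdd M]

namespace ModelsRCA0Star

variable (hM : ModelsRCA0Star 𝒳)
include hM

theorem exists_two_mul_eq (x : M) : ∃ y, 2 * y = x * (x + 1) := by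
  suffices h : ∃ y, y < x * (x + 1) + 1 ∧ 2 * y = x * (x + 1) from h.imp fun _ => And.right
  revert x
  refine hM.induct ?_ ⟨0, by simp⟩ ?_
  · exact .bex_term (.add (.mul (.proj 0) (.add (.proj 0) (.const 1))) (.const 1))
      (P := fun v y => 2 * y = v 0 * (v 0 + 1))
      (.eq_term (.mul (.const 2) (.proj 0)) (.mul (.proj 1) (.add (.proj 1) (.const 1))))
  · rintro x ⟨y, -, hy⟩
    have h : 2 * (y + (x + 1)) = (x + 1) * (x + 1 + 1) := by grind
    refine ⟨y + (x + 1), hM.lt_add_one.2 ?_, h⟩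
    rw [← h, two_mul]
    exact le_self_add

theorem isPair_pair (a b : M) : IsPair a b (pair a b) := by
  obtain ⟨y, hy⟩ := hM.exists_two_mul_eq (a + b)
  exact Classical.epsilon_spec (p := IsPair a b) ⟨y + b, by rw [IsPair, mul_add, hy]⟩

theorem isPair_iff {a b p : M} : IsPair a b p ↔ p = pair a b := by
  refine ⟨fun h => two_mul_cancel (h.trans (hM.isPair_pair a b).symm), ?_⟩
  rintro rfl
  exact hM.isPair_pair a b

/-- The codes on the antidiagonal `a' + b'` all lie strictly below those on any later antidiagonal.
-/
theorem pair_sum_le {a b a' b' : M} (h : pair a b = pair a' b') : a + b ≤ a' + b' := by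
  by_contra hlt
  have h₁ : IsPair a b (pair a b) := hM.isPair_pair a b
  have h₂ : IsPair a' b' (pair a b) := h ▸ hM.isPair_pair a' b'
  unfold IsPair at h₁ h₂
  have hle := hM.add_one_le (not_le.1 hlt)
  have : (a' + b' + 1) * (a' + b' + 1 + 1) ≤ (a + b) * (a + b + 1) :=
    mul_le_mul' hle (add_le_add_left hle 1)
  have e : (a' + b' + 1) * (a' + b' + 1 + 1) =
    (a' + b') * (a' + b' + 1) + 2 * b' + 2 * a' + 1 + 1 := by ring
  rw [e, ← h₂, h₁] at this
  refine absurd this (not_le.2 (lt_of_le_of_lt ?_ (_root_.lt_add_one _)))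
  rw [add_assoc, add_assoc, add_assoc]
  exact le_self_add

theorem pair_inj {a b a' b' : M} : pair a b = pair a' b' ↔ a = a' ∧ b = b' := by
  refine ⟨fun h => ?_, by rintro ⟨rfl, rfl⟩; rfl⟩
  have e : a + b = a' + b' := le_antisymm (hM.pair_sum_le h) (hM.pair_sum_le h.symm)
  have h₁ : IsPair a b (pair a b) := hM.isPair_pair a b
  have h₂ : IsPair a' b' (pair a b) := h ▸ hM.isPair_pair a' b'
  unfold IsPair at h₁ h₂
  rw [e] at h₁
  have hb : b = b' := two_mul_cancel (add_left_cancel (h₁.symm.trans h₂))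
  exact ⟨add_right_cancel (hb ▸ e), hb⟩

theorem unpairL_pair (a b : M) : unpairL (pair a b) = a := by
  obtain ⟨c, hc⟩ := Classical.epsilon_spec (p := fun x => ∃ y, IsPair x y (pair a b))
    ⟨a, b, hM.isPair_pair a b⟩
  exact ((hM.pair_inj.1 (hM.isPair_iff.1 hc)).1).symm

theorem unpairR_pair (a b : M) : unpairR (pair a b) = b := by
  obtain ⟨c, hc⟩ := Classical.epsilon_spec (p := fun y => ∃ x, IsPair x y (pair a b))
    ⟨b, a, hM.isPair_pair a b⟩
  exact ((hM.pair_inj.1 (hM.isPair_iff.1 hc)).2).symm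

theorem add_le_pair (a b : M) : a + b ≤ pair a b := by
  have h := hM.isPair_pair a b
  unfold IsPair at h
  rcases hM.eq_zero_or_exists_add_one (a + b) with hs | ⟨c, hc⟩
  · rw [hs]; exact zero_le
  · have : a + b ≤ (a + b) * (a + b) := by
      nth_rewrite 1 [← mul_one (a + b)]
      exact mul_le_mul' le_rfl (hc ▸ le_add_self)
    refine le_of_mul_le_mul_left ?_ (two_pos (α := M))
    rw [h, two_mul, mul_add (a + b) (a + b) 1, mul_one]
    exact (add_le_add_left this _).trans le_self_add

theorem left_le_pair (a b : M) : a ≤ pair a b := le_self_add.trans (hM.add_le_pair a b)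

theorem right_le_pair (a b : M) : b ≤ pair a b := le_add_self.trans (hM.add_le_pair a b)

theorem pair_mono {a b a' b' : M} (ha : a ≤ a') (hb : b ≤ b') : pair a b ≤ pair a' b' := by
  have h₁ := hM.isPair_pair a b
  have h₂ := hM.isPair_pair a' b'
  unfold IsPair at h₁ h₂
  refine le_of_mul_le_mul_left ?_ (two_pos (α := M))
  rw [h₁, h₂]
  gcongr

theorem exists_pair_eq (p : M) : ∃ a b, p = pair a b := by
  suffices h : ∃ a, a < p + 1 ∧ ∃ b, b < p + 1 ∧ IsPair a b p by
    obtain ⟨a, -, b, -, h⟩ := h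
    exact ⟨a, b, hM.isPair_iff.1 h⟩
  revert p
  refine hM.induct ?_ ⟨0, by simp, 0, by simp, by simp [IsPair]⟩ ?_
  · refine .bex_term (.add (.proj 0) (.const 1))
      (P := fun v a => ∃ b, b < v 0 + 1 ∧ IsPair a b (v 0)) ?_
    refine .bex_term (.add (.proj 1) (.const 1)) (P := fun v b => IsPair (v 0) b (v 1)) ?_
    exact isDelta0_isPair.rename ![1, 0, 2]
  · have bound : ∀ {a b p : M}, IsPair a b p →
        ∃ a, a < p + 1 ∧ ∃ b, b < p + 1 ∧ IsPair a b p := by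
      intro a b p h
      obtain rfl := hM.isPair_iff.1 h
      exact ⟨a, hM.lt_add_one.2 (hM.left_le_pair a b), b,
        hM.lt_add_one.2 (hM.right_le_pair a b), h⟩
    rintro p ⟨a, -, b, -, h⟩
    unfold IsPair at h
    -- Walk along the antidiagonals: `(0, b)` is followed by `(b + 1, 0)`, and `(c + 1, b)` by `(c,
    -- b + 1)`.
    rcases hM.eq_zero_or_exists_add_one a with rfl | ⟨c, rfl⟩
    · refine bound (a := b + 1) (b := 0) ?_
      unfold IsPair
      grind
    · refine bound (a := c) (b := b + 1) ?_
      unfold IsPair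
      grind

theorem pair_unpair (p : M) : pair (unpairL p) (unpairR p) = p := by
  obtain ⟨a, b, rfl⟩ := hM.exists_pair_eq p
  rw [hM.unpairL_pair, hM.unpairR_pair]

end ModelsRCA0Star

/-- In arity one, `Δ⁰₁` comprehension turns the relation into a set parameter, and membership in it
is atomic. Higher arities reduce to this by merging the first two variables into a pair. -/
theorem IsDelta0.of_delta1 (hM : ModelsRCA0Star 𝒳) {P : (Fin n → M) → Prop}
    {Q R : (Fin n → M) → M → Prop}
    (hQ : IsDelta0 𝒳 fun w : Fin (n + 1) → M => Q (fun i => w i.succ) (w 0))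
    (hR : IsDelta0 𝒳 fun w : Fin (n + 1) → M => R (fun i => w i.succ) (w 0))
    (h₁ : ∀ v, P v ↔ ∃ y, Q v y) (h₂ : ∀ v, P v ↔ ∀ y, R v y) : IsDelta0 𝒳 P := by
  induction n using Nat.twoStepInduction with
  | zero => exact (const (P ![])).congr fun v => by rw [Subsingleton.elim v ![]]
  | one =>
    have vec : ∀ v : Fin 1 → M, v = fun _ => v 0 := fun v => by
      funext i; rw [Subsingleton.elim i 0]
    have hmem : {x : M | P fun _ => x} ∈ 𝒳 := by
      obtain ⟨φ, hφ⟩ := hQ.rename (m := 2) ![1, 0]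
      obtain ⟨ψ, hψ⟩ := hR.rename (m := 2) ![1, 0]
      refine hM.comprehension _ ⟨φ, ?_⟩ ⟨ψ, ?_⟩
      · ext x
        simp only [Set.mem_ofPred_eq, hφ, h₁]
        refine exists_congr fun y => ?_
        exact iff_of_eq (congrArg₂ Q (funext fun i => by rw [Subsingleton.elim i 0]; rfl) rfl)
      · ext x
        simp only [Set.mem_ofPred_eq, hψ, h₂]
        refine forall_congr' fun y => ?_
        exact iff_of_eq (congrArg₂ R (funext fun i => by rw [Subsingleton.elim i 0]; rfl) rfl)
    refine (mem_term hmem (.proj 0)).congr fun v => ?_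
    rw [Set.mem_ofPred_eq, ← vec v]
  | more n _ ih =>
    let split : (Fin (n + 1) → M) → Fin (n + 2) → M := fun w =>
      Matrix.vecCons (unpairL (w 0)) (Matrix.vecCons (unpairR (w 0)) fun i => w i.succ)
    have split_pair : ∀ a b (w : Fin n → M),
        split (Matrix.vecCons (pair a b) w) = Matrix.vecCons a (Matrix.vecCons b w) := by
      intro a b w
      simp [split, hM.unpairL_pair, hM.unpairR_pair]
    have lift : ∀ {Q : (Fin (n + 2) → M) → M → Prop},
        IsDelta0 𝒳 (fun w : Fin (n + 3) → M => Q (fun i => w i.succ) (w 0)) →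
        IsDelta0 𝒳 fun w : Fin (n + 2) → M => Q (split fun i => w i.succ) (w 0) := by
      intro Q hQ
      have : IsDelta0 𝒳 fun w : Fin (n + 2) → M => ∃ a, a < w 1 + 1 ∧ ∃ b, b < w 1 + 1 ∧
          (IsPair a b (w 1) ∧
            Q (Matrix.vecCons a (Matrix.vecCons b fun i => w i.succ.succ)) (w 0)) := by
        refine .bex_term (.add (.proj 1) (.const 1))
          (P := fun w a => ∃ b, b < w 1 + 1 ∧ (IsPair a b (w 1) ∧
            Q (Matrix.vecCons a (Matrix.vecCons b fun i => w i.succ.succ)) (w 0))) ?_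
        refine .bex_term (.add (.proj 2) (.const 1))
          (P := fun w b => IsPair (w 0) b (w 2) ∧
            Q (Matrix.vecCons (w 0) (Matrix.vecCons b fun i => w i.succ.succ.succ)) (w 1)) ?_
        refine (isDelta0_isPair.rename ![1, 0, 3]).and ?_
        refine (hQ.rename (Matrix.vecCons 2 (Matrix.vecCons 1 (Matrix.vecCons 0
          fun i : Fin n => i.succ.succ.succ.succ)))).congr fun w => ?_
        refine iff_of_eq (congrArg₂ Q ?_ rfl)
        funext i
        cases i using Fin.cases with
        | zero => rfl
        | succ i => cases i using Fin.cases <;> rfl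
      refine this.congr fun w => ⟨fun h => ?_, ?_⟩
      · have hp := hM.isPair_pair (unpairL (w 1)) (unpairR (w 1))
        have hl := hM.left_le_pair (unpairL (w 1)) (unpairR (w 1))
        have hr := hM.right_le_pair (unpairL (w 1)) (unpairR (w 1))
        rw [hM.pair_unpair] at hp hl hr
        exact ⟨_, hM.lt_add_one.2 hl, _, hM.lt_add_one.2 hr, hp, h⟩
      · rintro ⟨a, -, b, -, hp, h⟩
        have e : (fun i : Fin (n + 1) => w i.succ) =
            Matrix.vecCons (pair a b) fun i => w i.succ.succ := by
          rw [← hM.isPair_iff.1 hp]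
          funext i
          cases i using Fin.cases <;> rfl
        rwa [e, split_pair]
    have key := ih (P := fun w => P (split w)) (lift hQ) (lift hR)
      (fun w => h₁ (split w)) (fun w => h₂ (split w))
    -- Only terms are available as bounds here, so the pair is bounded by twice its value, which is
    -- a polynomial.
    have : IsDelta0 𝒳 fun v : Fin (n + 2) → M =>
        ∃ p, p < (v 0 + v 1) * (v 0 + v 1 + 1) + 2 * v 1 + 1 ∧
          (IsPair (v 0) (v 1) p ∧ P (split (Matrix.vecCons p fun i => v i.succ.succ))) := by
      refine .bex_term
        (.add (.add (.mul (.add (.proj 0) (.proj 1)) (.add (.add (.proj 0) (.proj 1)) (.const 1)))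
          (.mul (.const 2) (.proj 1))) (.const 1))
        (P := fun v p => IsPair (v 0) (v 1) p ∧
          P (split (Matrix.vecCons p fun i => v i.succ.succ))) ?_
      refine (isDelta0_isPair.rename ![1, 2, 0]).and ?_
      let σ : Fin (n + 1) → Fin (n + 3) := Matrix.vecCons 0 fun i => i.succ.succ.succ
      have e : ∀ w : Fin (n + 3) → M,
          (Matrix.vecCons (w 0) fun i : Fin n => w i.succ.succ.succ) = fun i => w (σ i) := by
        intro w
        funext i
        cases i using Fin.cases <;> rfl
      exact (key.rename σ).congr fun w => iff_of_eq (by rw [← e w])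
    refine this.congr fun v => ?_
    have e : v = Matrix.vecCons (v 0) (Matrix.vecCons (v 1) fun i => v i.succ.succ) := by
      funext i
      cases i using Fin.cases with
      | zero => rfl
      | succ i => cases i using Fin.cases <;> rfl
    constructor
    · intro h
      refine ⟨pair (v 0) (v 1), hM.lt_add_one.2 ?_, hM.isPair_pair _ _, ?_⟩
      · rw [← hM.isPair_pair (v 0) (v 1), two_mul]
        exact le_self_add
      · rwa [split_pair, ← e]
    · rintro ⟨p, -, hp, h⟩
      rwa [hM.isPair_iff.1 hp, split_pair, ← e] at h

end Pairing

/-! ### Functions with `Δ⁰₀` graph and substitution -/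

section DefinableFunctions

variable {M : Type u} [CommSemiring M] [LinearOrder M] {𝒳 : Set (Set M)} {n m : ℕ}

/-- Functions with a `Δ⁰₀`-definable graph. -/
def IsDelta0Fn (𝒳 : Set (Set M)) (f : (Fin n → M) → M) : Prop :=
  IsDelta0 𝒳 fun w : Fin (n + 1) → M => w 0 = f fun i => w i.succ

theorem TermFn.isDelta0Fn {f : (Fin n → M) → M} (h : TermFn f) : IsDelta0Fn 𝒳 f :=
  .eq_term (.proj 0) (h.rename Fin.succ)

namespace IsDelta0Fn

theorem proj (i : Fin n) : IsDelta0Fn 𝒳 fun v => v i := (TermFn.proj i).isDelta0Fn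

theorem const (a : M) : IsDelta0Fn 𝒳 fun _ : Fin n → M => a := (TermFn.const a).isDelta0Fn

theorem rename {f : (Fin n → M) → M} (σ : Fin n → Fin m) (h : IsDelta0Fn 𝒳 f) :
    IsDelta0Fn 𝒳 fun v => f fun i => v (σ i) :=
  IsDelta0.rename (Fin.cons 0 fun i => (σ i).succ : Fin (n + 1) → Fin (m + 1)) h

end IsDelta0Fn

/-- `Δ⁰₀`-definable sets belong to the second-order part. -/
theorem IsDelta0.mem_model (hM : ModelsRCA0Star 𝒳) {P : M → Prop}
    (hP : IsDelta0 𝒳 fun v : Fin 1 → M => P (v 0)) :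
    {x | P x} ∈ 𝒳 := by
  obtain ⟨φ, hφ⟩ := hP.rename (m := 2) ![0]
  refine hM.comprehension _ ⟨φ, ?_⟩ ⟨φ, ?_⟩ <;> ext x <;> simp [hφ]

variable [IsStrictOrderedRing M] [CanonicallyOrderedAdd M] (hM : ModelsRCA0Star 𝒳)
  {f g : (Fin n → M) → M}
include hM

namespace IsDelta0

/-- The value can be introduced existentially or universally, which gives a `Δ⁰₁` definition without
any bound on `f`. -/
theorem subst (hf : IsDelta0Fn 𝒳 f) {P : (Fin n → M) → M → Prop}
    (hP : IsDelta0 𝒳 fun w : Fin (n + 1) → M => P (fun i => w i.succ) (w 0)) :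
    IsDelta0 𝒳 fun v => P v (f v) :=
  of_delta1 hM (Q := fun v y => y = f v ∧ P v y) (R := fun v y => y = f v → P v y)
    (IsDelta0.and hf hP) (IsDelta0.imp hf hP) (fun v => by simp) (fun v => by simp)

theorem comp₁ {P : M → Prop} (hP : IsDelta0 𝒳 fun v : Fin 1 → M => P (v 0))
    (hf : IsDelta0Fn 𝒳 f) : IsDelta0 𝒳 fun v => P (f v) :=
  subst hM hf (P := fun _ y => P y) (hP.rename ![0])

theorem comp₂ {P : M → M → Prop} (hP : IsDelta0 𝒳 fun v : Fin 2 → M => P (v 0) (v 1))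
    (hf : IsDelta0Fn 𝒳 f) (hg : IsDelta0Fn 𝒳 g) : IsDelta0 𝒳 fun v => P (f v) (g v) :=
  subst hM hf (P := fun v y => P y (g v)) <|
    subst hM (hg.rename Fin.succ) (P := fun v y => P (v 0) y) (hP.rename ![1, 0])

theorem comp₃ {P : M → M → M → Prop} (hP : IsDelta0 𝒳 fun v : Fin 3 → M => P (v 0) (v 1) (v 2))
    {h : (Fin n → M) → M} (hf : IsDelta0Fn 𝒳 f) (hg : IsDelta0Fn 𝒳 g) (hh : IsDelta0Fn 𝒳 h) :
    IsDelta0 𝒳 fun v => P (f v) (g v) (h v) :=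
  subst hM hf (P := fun v y => P y (g v) (h v)) <|
    subst hM (hg.rename Fin.succ) (P := fun v y => P (v 0) y (h fun i => v i.succ)) <|
      subst hM (hh.rename fun i => i.succ.succ) (P := fun v y => P (v 1) (v 0) y)
        (hP.rename ![2, 1, 0])

theorem eq (hf : IsDelta0Fn 𝒳 f) (hg : IsDelta0Fn 𝒳 g) : IsDelta0 𝒳 fun v => f v = g v :=
  comp₂ hM (P := (· = ·)) (eq_term (.proj 0) (.proj 1)) hf hg

theorem lt (hf : IsDelta0Fn 𝒳 f) (hg : IsDelta0Fn 𝒳 g) : IsDelta0 𝒳 fun v => f v < g v :=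
  comp₂ hM (P := (· < ·)) (lt_term (.proj 0) (.proj 1)) hf hg

theorem le (hf : IsDelta0Fn 𝒳 f) (hg : IsDelta0Fn 𝒳 g) : IsDelta0 𝒳 fun v => f v ≤ g v :=
  comp₂ hM (P := (· ≤ ·)) (le_term (.proj 0) (.proj 1)) hf hg

theorem mem {X : Set M} (hX : X ∈ 𝒳) (hf : IsDelta0Fn 𝒳 f) : IsDelta0 𝒳 fun v => f v ∈ X :=
  comp₁ hM (P := (· ∈ X)) (mem_term hX (.proj 0)) hf

theorem ball (hf : IsDelta0Fn 𝒳 f) {P : (Fin n → M) → M → Prop}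
    (hP : IsDelta0 𝒳 fun w : Fin (n + 1) → M => P (fun i => w i.succ) (w 0)) :
    IsDelta0 𝒳 fun v => ∀ a, a < f v → P v a := by
  refine subst hM hf (P := fun v y => ∀ a, a < y → P v a)
    (ball_term (.proj 0) (P := fun w a => P (fun i => w i.succ) a) ?_)
  exact hP.rename (Fin.cons 0 fun i => i.succ.succ : Fin (n + 1) → Fin (n + 2))

theorem bex (hf : IsDelta0Fn 𝒳 f) {P : (Fin n → M) → M → Prop}
    (hP : IsDelta0 𝒳 fun w : Fin (n + 1) → M => P (fun i => w i.succ) (w 0)) :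
    IsDelta0 𝒳 fun v => ∃ a, a < f v ∧ P v a := by
  refine subst hM hf (P := fun v y => ∃ a, a < y ∧ P v a)
    (bex_term (.proj 0) (P := fun w a => P (fun i => w i.succ) a) ?_)
  exact hP.rename (Fin.cons 0 fun i => i.succ.succ : Fin (n + 1) → Fin (n + 2))

end IsDelta0

namespace IsDelta0Fn

theorem comp₁ {F : M → M} (hF : IsDelta0Fn 𝒳 fun v : Fin 1 → M => F (v 0))
    (hf : IsDelta0Fn 𝒳 f) : IsDelta0Fn 𝒳 fun v => F (f v) :=
  IsDelta0.comp₂ hM (P := fun y x => y = F x) hF (proj 0) (hf.rename Fin.succ)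

theorem comp₂ {F : M → M → M} (hF : IsDelta0Fn 𝒳 fun v : Fin 2 → M => F (v 0) (v 1))
    (hf : IsDelta0Fn 𝒳 f) (hg : IsDelta0Fn 𝒳 g) : IsDelta0Fn 𝒳 fun v => F (f v) (g v) :=
  IsDelta0.comp₃ hM (P := fun y a b => y = F a b) hF (proj 0) (hf.rename Fin.succ)
    (hg.rename Fin.succ)

theorem add (hf : IsDelta0Fn 𝒳 f) (hg : IsDelta0Fn 𝒳 g) : IsDelta0Fn 𝒳 fun v => f v + g v :=
  comp₂ hM (F := (· + ·)) ((TermFn.proj 0).add (.proj 1)).isDelta0Fn hf hg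

theorem mul (hf : IsDelta0Fn 𝒳 f) (hg : IsDelta0Fn 𝒳 g) : IsDelta0Fn 𝒳 fun v => f v * g v :=
  comp₂ hM (F := (· * ·)) ((TermFn.proj 0).mul (.proj 1)).isDelta0Fn hf hg

theorem pair (hf : IsDelta0Fn 𝒳 f) (hg : IsDelta0Fn 𝒳 g) :
    IsDelta0Fn 𝒳 fun v => pair (f v) (g v) := by
  refine comp₂ hM (F := Arith.pair) ?_ hf hg
  exact (isDelta0_isPair.rename ![1, 2, 0]).congr fun v => hM.isPair_iff.symm

theorem unpairL (hf : IsDelta0Fn 𝒳 f) : IsDelta0Fn 𝒳 fun v => unpairL (f v) := by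
  refine comp₁ hM (F := Arith.unpairL) ?_ hf
  refine (IsDelta0.bex hM (f := fun v : Fin 2 → M => v 1 + 1)
    (P := fun v b => IsPair (v 0) b (v 1)) (add hM (proj 1) (const 1))
    (isDelta0_isPair.rename ![1, 0, 2])).congr fun v => ?_
  change v 0 = Arith.unpairL (v 1) ↔ _
  constructor
  · intro h
    have e := hM.pair_unpair (v 1)
    rw [← h] at e
    exact ⟨Arith.unpairR (v 1), hM.lt_add_one.2 ((hM.right_le_pair _ _).trans_eq e),
      hM.isPair_iff.2 e.symm⟩
  · rintro ⟨b, -, h⟩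
    rw [hM.isPair_iff.1 h]
    exact (hM.unpairL_pair _ _).symm

theorem unpairR (hf : IsDelta0Fn 𝒳 f) : IsDelta0Fn 𝒳 fun v => unpairR (f v) := by
  refine comp₁ hM (F := Arith.unpairR) ?_ hf
  refine (IsDelta0.bex hM (f := fun v : Fin 2 → M => v 1 + 1)
    (P := fun v a => IsPair a (v 0) (v 1)) (add hM (proj 1) (const 1))
    (isDelta0_isPair.rename ![0, 1, 2])).congr fun v => ?_
  change v 0 = Arith.unpairR (v 1) ↔ _
  constructor
  · intro h
    have e := hM.pair_unpair (v 1)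
    rw [← h] at e
    exact ⟨Arith.unpairL (v 1), hM.lt_add_one.2 ((hM.left_le_pair _ _).trans_eq e),
      hM.isPair_iff.2 e.symm⟩
  · rintro ⟨a, -, h⟩
    rw [hM.isPair_iff.1 h]
    exact (hM.unpairR_pair _ _).symm

end IsDelta0Fn

end DefinableFunctions

/-! ### Coding of tuples -/

section Tuples

variable {M : Type u} [CommSemiring M] [LinearOrder M] {𝒳 : Set (Set M)} {n m : ℕ}

/-- The code of a tuple. -/
noncomputable def tupleCode : {m : ℕ} → (Fin m → M) → M
  | 0, _ => 0
  | 1, x => x 0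
  | _ + 2, x => pair (x 0) (tupleCode (Fin.tail x))

/-- The tuple coded by a number. -/
noncomputable def untuple : (m : ℕ) → M → Fin m → M
  | 0, _ => Fin.elim0
  | 1, p => fun _ => p
  | m + 2, p => (Fin.cons (unpairL p) (untuple (m + 1) (unpairR p)) : Fin (m + 2) → M)

variable [IsStrictOrderedRing M] [CanonicallyOrderedAdd M] (hM : ModelsRCA0Star 𝒳)
include hM

namespace ModelsRCA0Star

theorem isTupleCode_iff : ∀ {m : ℕ} {x : Fin m → M} {p : M}, IsTupleCode x p ↔ p = tupleCode x
  | 0, _, _ => Iff.rfl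
  | 1, _, _ => Iff.rfl
  | m + 2, x, p => by
    simp only [IsTupleCode, tupleCode, isTupleCode_iff (x := Fin.tail x), hM.isPair_iff]
    simp

theorem untuple_tupleCode : ∀ {m : ℕ} (x : Fin m → M), untuple m (tupleCode x) = x
  | 0, x => Subsingleton.elim _ _
  | 1, x => by
    funext i
    rw [Subsingleton.elim i 0]
    rfl
  | m + 2, x => by
    rw [untuple, tupleCode, hM.unpairL_pair, hM.unpairR_pair, untuple_tupleCode]
    exact Fin.cons_self_tail x

theorem tupleCode_untuple : ∀ (m : ℕ) (p : M), tupleCode (untuple (m + 1) p) = p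
  | 0, p => rfl
  | m + 1, p => by
    rw [untuple, tupleCode, Fin.cons_zero, Fin.tail_cons, tupleCode_untuple, hM.pair_unpair]

theorem tupleCode_mono : ∀ {m : ℕ} {x y : Fin m → M}, (∀ i, x i ≤ y i) →
    tupleCode x ≤ tupleCode y
  | 0, _, _, _ => le_rfl
  | 1, _, _, h => h 0
  | _ + 2, _, _, h => hM.pair_mono (h 0) (tupleCode_mono fun i => h i.succ)

end ModelsRCA0Star

namespace IsDelta0Fn

theorem tupleCode : ∀ {m : ℕ} {f : Fin m → (Fin n → M) → M}, (∀ i, IsDelta0Fn 𝒳 (f i)) →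
    IsDelta0Fn 𝒳 fun v => tupleCode fun i => f i v
  | 0, _, _ => const 0
  | 1, _, h => h 0
  | _ + 2, _, h => pair hM (h 0) (tupleCode fun i => h i.succ)

theorem untuple : ∀ {m : ℕ} (i : Fin m) {f : (Fin n → M) → M}, IsDelta0Fn 𝒳 f →
    IsDelta0Fn 𝒳 fun v => untuple m (f v) i
  | 1, _, _, h => h
  | m + 2, i, f, h => by
    cases i using Fin.cases with
    | zero => exact unpairL hM h
    | succ i => exact untuple i (unpairR hM h)

end IsDelta0Fn

end Tuples

/-! ### Division, the `β` function and exponentiation -/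

section Exponentiation

variable {M : Type u} [CommSemiring M] [LinearOrder M] {𝒳 : Set (Set M)} {n m : ℕ}

/-- The exponential function with base `2`. -/
noncomputable def pow2 (x : M) : M := Classical.epsilon (IsPow2 x)

/-- `p` codes parameters for the `β` function of a sequence of successive powers of `2` whose
`x`-th term is `y`. -/
def PowSeq (p x y : M) : Prop :=
  IsBeta (unpairL p) (unpairR p) 0 1 ∧
    (∀ i, i < x → ∃ v, v < unpairL p + 1 ∧ (IsBeta (unpairL p) (unpairR p) i v ∧
      IsBeta (unpairL p) (unpairR p) (i + 1) (2 * v))) ∧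
    IsBeta (unpairL p) (unpairR p) x y

variable [CanonicallyOrderedAdd M]

theorem IsBeta.le {a b i v : M} : IsBeta a b i v → v ≤ a
  | ⟨_, _, e⟩ => e ▸ le_add_self

variable [IsStrictOrderedRing M] (hM : ModelsRCA0Star 𝒳)
include hM

namespace ModelsRCA0Star

theorem quot_le {m q q' r r' : M} (hr' : r' < m) (h : q * m + r = q' * m + r') : q ≤ q' := by
  by_contra hlt
  have h₁ : (q' + 1) * m ≤ q * m := mul_le_mul' (hM.add_one_le (not_le.1 hlt)) le_rfl
  have h₂ : q' * m + r' < q * m :=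
    (add_lt_add_right hr' (q' * m)).trans_le (by simpa [add_mul] using h₁)
  exact absurd h (ne_of_gt (h₂.trans_le le_self_add))

theorem div_unique {m q q' r r' : M} (hr : r < m) (hr' : r' < m)
    (h : q * m + r = q' * m + r') : q = q' ∧ r = r' := by
  have e := le_antisymm (hM.quot_le hr' h) (hM.quot_le hr h.symm)
  subst e
  exact ⟨rfl, add_left_cancel h⟩

omit [IsStrictOrderedRing M] in
theorem le_mul_pos {m : M} (hm : 0 < m) (q : M) : q ≤ q * m := by
  nth_rewrite 1 [← mul_one q]
  exact mul_le_mul' le_rfl (hM.discrete m hm)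

theorem exists_div {m : M} (hm : 0 < m) (s : M) : ∃ q r, r < m ∧ s = q * m + r := by
  suffices h : ∃ q, q < s + 1 ∧ ∃ r, r < m ∧ s = q * m + r by
    obtain ⟨q, -, h⟩ := h
    exact ⟨q, h⟩
  revert s
  refine hM.induct ?_ ⟨0, by simp, 0, hm, by simp⟩ ?_
  · refine .bex_term (.add (.proj 0) (.const 1)) (P := fun v q => ∃ r, r < m ∧ v 0 = q * m + r) ?_
    refine .bex_term (.const m) (P := fun v r => v 1 = v 0 * m + r) ?_
    exact .eq_term (.proj 2) (.add (.mul (.proj 1) (.const m)) (.proj 0))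
  · have bound : ∀ {q r s : M}, r < m → s = q * m + r →
        ∃ q, q < s + 1 ∧ ∃ r, r < m ∧ s = q * m + r := fun {q r s} hr h =>
      ⟨q, hM.lt_add_one.2 (h ▸ (hM.le_mul_pos hm q).trans le_self_add), r, hr, h⟩
    rintro s ⟨q, -, r, hr, rfl⟩
    rcases (hM.add_one_le hr).eq_or_lt with h | h
    · exact bound (q := q + 1) hm (by rw [add_assoc, h, add_mul, one_mul, add_zero])
    · exact bound h (add_assoc _ _ _)

theorem isBeta_unique {a b i v v' : M} : IsBeta a b i v → IsBeta a b i v' → v = v'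
  | ⟨h, _, e⟩, ⟨h', _, e'⟩ => (hM.div_unique h h' (e.symm.trans e')).2

end ModelsRCA0Star

theorem IsDelta0.isBeta {a b i v : (Fin n → M) → M} (ha : IsDelta0Fn 𝒳 a) (hb : IsDelta0Fn 𝒳 b)
    (hi : IsDelta0Fn 𝒳 i) (hv : IsDelta0Fn 𝒳 v) :
    IsDelta0 𝒳 fun w => IsBeta (a w) (b w) (i w) (v w) := by
  have hmod : IsDelta0Fn 𝒳 fun w => 1 + (i w + 1) * b w :=
    .add hM (.const 1) (.mul hM (.add hM hi (.const 1)) hb)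
  refine IsDelta0.congr (.and (.lt hM hv hmod) (.bex hM (.add hM ha (.const 1))
    (P := fun w q => a w = q * (1 + (i w + 1) * b w) + v w)
    (.eq hM (ha.rename Fin.succ) (.add hM (.mul hM (.proj 0) (hmod.rename Fin.succ))
      (hv.rename Fin.succ))))) fun w => and_congr_right fun _ => exists_congr fun q => ?_
  refine ⟨fun h => ⟨hM.lt_add_one.2 ?_, h⟩, And.right⟩
  rw [h]
  exact (hM.le_mul_pos (zero_lt_one.trans_le le_self_add) q).trans le_self_add

namespace ModelsRCA0Star

theorem isPow2_unique {x y y' : M} : IsPow2 x y → IsPow2 x y' → y = y' := by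
  rintro ⟨a, b, h0, hs, hx⟩ ⟨a', b', h0', hs', hx'⟩
  -- Both sequences agree up to `x`. The bound `a + 1`, valid for every value of `β`, makes the
  -- induction `Δ⁰₀`.
  have key : ∀ i, i ≤ x → ∃ v, v < a + 1 ∧ (IsBeta a b i v ∧ IsBeta a' b' i v) := by
    refine hM.induct ?_ (fun _ => ⟨1, hM.lt_add_one.2 (IsBeta.le h0), h0, h0'⟩) ?_
    · refine .imp (.le_term (.proj 0) (.const x)) (.bex_term (.const (a + 1))
        (P := fun w v => IsBeta a b (w 0) v ∧ IsBeta a' b' (w 0) v) ?_)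
      exact .and (.isBeta hM (.const a) (.const b) (.proj 1) (.proj 0))
        (.isBeta hM (.const a') (.const b') (.proj 1) (.proj 0))
    · intro i ih hi
      have hlt := (_root_.lt_add_one i).trans_le hi
      obtain ⟨v, -, hv, hv'⟩ := ih hlt.le
      obtain ⟨u, hu, hu₂⟩ := hs i hlt
      obtain ⟨u', hu', hu₂'⟩ := hs' i hlt
      obtain rfl := hM.isBeta_unique hv hu
      obtain rfl := hM.isBeta_unique hv' hu'
      exact ⟨2 * v, hM.lt_add_one.2 (IsBeta.le hu₂), hu₂, hu₂'⟩
  obtain ⟨v, -, hv, hv'⟩ := key x le_rfl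
  rw [hM.isBeta_unique hx hv, hM.isBeta_unique hx' hv']

theorem isPow2_iff {x y : M} : IsPow2 x y ↔ y = pow2 x := by
  have h : IsPow2 x (pow2 x) := Classical.epsilon_spec (hM.exp x)
  exact ⟨fun hy => hM.isPow2_unique hy h, fun hy => hy ▸ h⟩

theorem pow2_zero : pow2 (0 : M) = 1 := by
  obtain ⟨a, b, h, -, h'⟩ := hM.isPow2_iff.2 (rfl : pow2 (0 : M) = pow2 0)
  exact hM.isBeta_unique h' h

theorem pow2_add_one (x : M) : pow2 (x + 1) = 2 * pow2 x := by
  obtain ⟨a, b, h, hs, hx⟩ := hM.isPow2_iff.2 (rfl : pow2 (x + 1) = pow2 (x + 1))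
  obtain ⟨v, hv, hv₂⟩ := hs x (_root_.lt_add_one x)
  -- The sequence that computes `pow2 (x + 1)`, stopped one step early, computes `pow2 x`.
  have : IsPow2 x v := ⟨a, b, h, fun i hi => hs i (hi.trans (_root_.lt_add_one x)), hv⟩
  rw [hM.isBeta_unique hx hv₂, hM.isPow2_iff.1 this]

theorem isPow2_iff_powSeq {x y : M} : IsPow2 x y ↔ ∃ p, PowSeq p x y := by
  constructor
  · rintro ⟨a, b, h, hs, hx⟩
    refine ⟨pair a b, ?_⟩
    simp only [PowSeq, hM.unpairL_pair, hM.unpairR_pair]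
    refine ⟨h, fun i hi => ?_, hx⟩
    obtain ⟨v, hv⟩ := hs i hi
    exact ⟨v, hM.lt_add_one.2 (IsBeta.le hv.1), hv⟩
  · rintro ⟨p, h, hs, hx⟩
    exact ⟨_, _, h, fun i hi => (hs i hi).imp fun v => And.right, hx⟩

end ModelsRCA0Star

theorem isDelta0_powSeq : IsDelta0 𝒳 fun v : Fin 3 → M => PowSeq (v 0) (v 1) (v 2) := by
  refine .and ?_ (.and ?_ ?_)
  · exact .isBeta hM (.unpairL hM (.proj 0)) (.unpairR hM (.proj 0)) (.const 0) (.const 1)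
  · refine .ball hM (.proj 1) (P := fun w i => ∃ v, v < unpairL (w 0) + 1 ∧
      (IsBeta (unpairL (w 0)) (unpairR (w 0)) i v ∧
        IsBeta (unpairL (w 0)) (unpairR (w 0)) (i + 1) (2 * v))) ?_
    refine .bex hM (.add hM (.unpairL hM (.proj 1)) (.const 1)) (P := fun w v =>
      (IsBeta (unpairL (w 1)) (unpairR (w 1)) (w 0) v ∧
        IsBeta (unpairL (w 1)) (unpairR (w 1)) (w 0 + 1) (2 * v))) ?_
    refine .and ?_ ?_
    · exact .isBeta hM (.unpairL hM (.proj 2)) (.unpairR hM (.proj 2)) (.proj 1) (.proj 0)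
    · exact .isBeta hM (.unpairL hM (.proj 2)) (.unpairR hM (.proj 2))
        (.add hM (.proj 1) (.const 1)) (.mul hM (.const 2) (.proj 0))
  · exact .isBeta hM (.unpairL hM (.proj 0)) (.unpairR hM (.proj 0)) (.proj 1) (.proj 2)

/-- The graph is `Σ⁰₁` by the existence of a computation, and `Π⁰₁` because every computation for
the same argument yields the same value. That value is at most the first component of the code,
which bounds the inner quantifier. -/
theorem IsDelta0Fn.pow2 {f : (Fin n → M) → M} (hf : IsDelta0Fn 𝒳 f) :
    IsDelta0Fn 𝒳 fun v => pow2 (f v) := by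
  refine comp₁ hM (F := Arith.pow2) ?_ hf
  refine IsDelta0.of_delta1 hM (Q := fun v p => PowSeq p (v 1) (v 0))
    (R := fun v p => ∀ z, z < Arith.unpairL p + 1 → (PowSeq p (v 1) z → z = v 0))
    ((isDelta0_powSeq hM).rename ![0, 2, 1]) ?_ ?_ ?_
  · refine .ball hM (.add hM (.unpairL hM (.proj 0)) (.const 1))
      (P := fun w z => PowSeq (w 0) (w 2) z → z = w 1) ?_
    exact .imp ((isDelta0_powSeq hM).rename ![1, 3, 0]) (.eq hM (.proj 0) (.proj 2))
  · intro v
    exact hM.isPow2_iff.symm.trans hM.isPow2_iff_powSeq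
  · intro v
    change v 0 = Arith.pow2 (v 1) ↔ _
    constructor
    · intro h p z _ hz
      exact (hM.isPow2_iff.1 (hM.isPow2_iff_powSeq.2 ⟨p, hz⟩)).trans h.symm
    · intro h
      obtain ⟨p, hp⟩ := hM.isPow2_iff_powSeq.1 (hM.isPow2_iff.2 (rfl : Arith.pow2 (v 1) = _))
      exact (h p _ (hM.lt_add_one.2 (IsBeta.le hp.2.2)) hp).symm

namespace ModelsRCA0Star

theorem pow2_add (x y : M) : pow2 (x + y) = pow2 x * pow2 y := by
  revert y
  refine hM.induct ?_ (by simp [hM.pow2_zero]) fun y h => ?_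
  · exact .eq hM (.pow2 hM (.add hM (.const x) (.proj 0)))
      (.mul hM (.const _) (.pow2 hM (.proj 0)))
  · rw [← add_assoc, hM.pow2_add_one, h, hM.pow2_add_one, mul_left_comm]

theorem pow2_pos (x : M) : 0 < pow2 x := by
  revert x
  refine hM.induct (.lt hM (.const 0) (.pow2 hM (.proj 0))) ?_ fun x h => ?_
  · rw [hM.pow2_zero]
    exact zero_lt_one
  · rw [hM.pow2_add_one]
    exact mul_pos two_pos h

/-! ### Binary codes of bounded sets, and separation -/

theorem ackMem_iff {a s : M} :
    AckMem a s ↔ ∃ q r, r < pow2 a ∧ s = (2 * q + 1) * pow2 a + r := by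
  simp [AckMem, hM.isPow2_iff]

end ModelsRCA0Star

theorem IsDelta0.ackMem {f g : (Fin n → M) → M} (hf : IsDelta0Fn 𝒳 f) (hg : IsDelta0Fn 𝒳 g) :
    IsDelta0 𝒳 fun v => AckMem (f v) (g v) := by
  have : IsDelta0 𝒳 fun v => ∃ q, q < g v + 1 ∧ ∃ r, r < pow2 (f v) ∧
      g v = (2 * q + 1) * pow2 (f v) + r := by
    refine .bex hM (.add hM hg (.const 1))
      (P := fun v q => ∃ r, r < pow2 (f v) ∧ g v = (2 * q + 1) * pow2 (f v) + r) ?_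
    refine .bex hM (.pow2 hM (hf.rename Fin.succ))
      (P := fun w r => g (fun i => w i.succ) =
        (2 * w 0 + 1) * Arith.pow2 (f fun i => w i.succ) + r) ?_
    refine .eq hM (hg.rename fun i => i.succ.succ) (.add hM (.mul hM
      (.add hM (.mul hM (.const 2) (.proj 1)) (.const 1)) (.pow2 hM
        (hf.rename fun i => i.succ.succ))) (.proj 0))
  refine this.congr fun v => hM.ackMem_iff.trans (exists_congr fun q => ?_)
  refine ⟨fun h => ⟨?_, h⟩, And.right⟩
  obtain ⟨r, -, h⟩ := h
  rw [hM.lt_add_one, h]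
  refine le_trans ?_ ((hM.le_mul_pos (hM.pow2_pos (f v)) _).trans le_self_add)
  rw [two_mul, add_assoc]
  exact le_self_add

namespace ModelsRCA0Star

/-- For `a < b` the number `2 ^ b` is an even multiple of `2 ^ a`, so adding it preserves the parity
of the quotient by `2 ^ a`. -/
theorem ackMem_add_pow2_of_lt {a b : M} (hab : a < b) (s : M) :
    AckMem a (s + pow2 b) ↔ AckMem a s := by
  obtain ⟨c, rfl⟩ := le_iff_exists_add.1 (hM.add_one_le hab)
  have e : pow2 (a + 1 + c) = 2 * pow2 c * pow2 a := by
    rw [hM.pow2_add, hM.pow2_add_one]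
    ring
  rw [hM.ackMem_iff, hM.ackMem_iff, e]
  constructor
  · rintro ⟨q, r, hr, h⟩
    obtain ⟨Q, r', hr', rfl⟩ := hM.exists_div (hM.pow2_pos a) s
    obtain ⟨t, ε, hε, rfl⟩ := hM.exists_div (two_pos (α := M)) Q
    have h₁ : (t * 2 + ε + 2 * pow2 c) * pow2 a + r' = (2 * q + 1) * pow2 a + r := by
      rw [← h]
      ring
    have h₂ := (hM.div_unique hr' hr h₁).1
    have h₃ : (t + pow2 c) * 2 + ε = q * 2 + 1 := by
      rw [mul_comm q, ← h₂]
      ring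
    obtain rfl := (hM.div_unique hε one_lt_two h₃).2
    exact ⟨t, r', hr', by rw [mul_comm 2 t]⟩
  · rintro ⟨q, r, hr, rfl⟩
    exact ⟨q + pow2 c, r, hr, by ring⟩

theorem ackMem_add_pow2_self {b s : M} (hs : s < pow2 b) : AckMem b (s + pow2 b) :=
  hM.ackMem_iff.2 ⟨0, s, hs, by ring⟩

theorem not_ackMem_of_lt {b s : M} (hs : s < pow2 b) : ¬ AckMem b s := by
  rw [hM.ackMem_iff]
  rintro ⟨q, r, -, rfl⟩
  refine absurd hs (not_lt.2 ?_)
  rw [add_mul, one_mul]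
  exact le_add_self.trans le_self_add

/-- Build the code bit by bit, adding `2 ^ b` when `P b` holds. The bound on `s` keeps the induction
`Δ⁰₀` and leaves only `2 ^ b` candidates for `exists_separation`. -/
theorem exists_code {P : M → Prop} (hP : IsDelta0 𝒳 fun v : Fin 1 → M => P (v 0)) (b : M) :
    ∃ s, s < pow2 b ∧ ∀ a, a < b → (AckMem a s ↔ P a) := by
  revert b
  refine hM.induct ?_ ⟨0, hM.pow2_pos 0, fun a h => absurd h not_lt_zero⟩ ?_
  · refine .bex hM (.pow2 hM (.proj 0)) (P := fun v s => ∀ a, a < v 0 → (AckMem a s ↔ P a)) ?_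
    refine .ball hM (.proj 1) (P := fun v a => AckMem a (v 0) ↔ P a) ?_
    exact .iff (.ackMem hM (.proj 0) (.proj 1)) (.comp₁ hM hP (.proj 0))
  · rintro b ⟨s, hs, h⟩
    have e : pow2 (b + 1) = pow2 b + pow2 b := by rw [hM.pow2_add_one, two_mul]
    by_cases hb : P b
    · refine ⟨s + pow2 b, e ▸ add_lt_add_left hs _, fun a ha => ?_⟩
      rcases (hM.lt_add_one.1 ha).eq_or_lt with rfl | ha
      · exact iff_of_true (hM.ackMem_add_pow2_self hs) hb
      · rw [hM.ackMem_add_pow2_of_lt ha, h a ha]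
    · refine ⟨s, e ▸ hs.trans_le le_self_add, fun a ha => ?_⟩
      rcases (hM.lt_add_one.1 ha).eq_or_lt with rfl | ha
      · exact iff_of_false (hM.not_ackMem_of_lt hs) hb
      · exact h a ha

omit [IsStrictOrderedRing M] [CanonicallyOrderedAdd M] in
theorem collect {R : M → M → Prop} (hR : IsDelta0 𝒳 fun v : Fin 2 → M => R (v 0) (v 1)) (v : M)
    (h : ∀ x, x < v → ∃ y, R x y) : ∃ w, ∀ x, x < v → ∃ y, y < w ∧ R x y := by
  obtain ⟨φ, hφ⟩ := hR.rename (m := 3) ![0, 1]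
  have e : ∀ x y z : M, φ.Realize ![x, y, z] ↔ R x y := fun x y z => hφ _
  obtain ⟨w, hw⟩ := hM.collection φ v fun x hx => by simpa [e] using h x hx
  exact ⟨w, fun x hx => by simpa [e] using hw x hx⟩

/-- Disjoint `Σ⁰₁` sets are separated by a coded set below any bound. -/
theorem exists_separation {P Q : M → M → Prop}
    (hP : IsDelta0 𝒳 fun v : Fin 2 → M => P (v 0) (v 1))
    (hQ : IsDelta0 𝒳 fun v : Fin 2 → M => Q (v 0) (v 1))
    (hPQ : ∀ x y z, P x y → ¬ Q x z) (b : M) :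
    ∃ s, ∀ x, x < b → (∀ y, P x y → AckMem x s) ∧ ∀ y, Q x y → ¬ AckMem x s := by
  by_contra! hc
  -- If every `s < 2 ^ b` fails to separate, collection bounds the witnesses of failure by a single
  -- `w`.
  obtain ⟨w, hw⟩ := hM.collect
    (R := fun s y => ∃ x, x < b ∧ (P x y ∧ ¬ AckMem x s ∨ Q x y ∧ AckMem x s))
    (.bex hM (.const b)
      (P := fun v x => P x (v 1) ∧ ¬ AckMem x (v 0) ∨ Q x (v 1) ∧ AckMem x (v 0))
      (.or (.and (hP.rename ![0, 2]) (.not (.ackMem hM (.proj 0) (.proj 1))))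
        (.and (hQ.rename ![0, 2]) (.ackMem hM (.proj 0) (.proj 1)))))
    (pow2 b) fun s _ => by
      obtain ⟨x, hx, h⟩ := hc s
      by_cases hs : ∃ y, P x y ∧ ¬ AckMem x s
      · obtain ⟨y, hy⟩ := hs
        exact ⟨y, x, hx, .inl hy⟩
      · push Not at hs
        obtain ⟨y, hy⟩ := h hs
        exact ⟨y, x, hx, .inr hy⟩
  -- The set of `x` with a `P`-witness below `w` has a code among the candidates, and this code
  -- cannot fail with a witness below `w`.
  obtain ⟨s, hs, h⟩ := hM.exists_code (P := fun x => ∃ y, y < w ∧ P x y)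
    (.bex hM (.const w) (P := fun v y => P (v 0) y) (hP.rename ![1, 0])) b
  obtain ⟨y, hy, x, hx, h' | h'⟩ := hw s hs
  · exact h'.2 ((h x hx).2 ⟨y, hy, h'.1⟩)
  · obtain ⟨z, -, hz⟩ := (h x hx).1 h'.2
    exact hPQ x z y hz h'.1

end ModelsRCA0Star

end Exponentiation

/-! ### Increasing cofinal enumeration of `M` along the cut -/

section Enumeration

variable {M : Type u} [CommSemiring M] [LinearOrder M] {𝒳 : Set (Set M)} {n m : ℕ}

/-- `G` is the graph of a `Δ⁰₀`-definable strictly increasing cofinal map from `I` to `M`. -/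
structure Enumerates (𝒳 : Set (Set M)) (I : Set M) (G : M → M → Prop) : Prop where
  delta0 : IsDelta0 𝒳 fun v : Fin 2 → M => G (v 0) (v 1)
  mem_iff : ∀ x, x ∈ I ↔ ∃ y, G x y
  unique : ∀ x y y', G x y → G x y' → y = y'
  strictMono : ∀ x x' y y', x < x' → G x y → G x' y' → y < y'
  cofinal : ∀ b, ∃ x y, G x y ∧ b ≤ y

/-- The image of `x` under the function with graph `G`. -/
noncomputable def value (G : M → M → Prop) (x : M) : M := Classical.epsilon (G x)

/-- The least `x` whose image under the function with graph `G` is not below `y`. -/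
noncomputable def index (G : M → M → Prop) (y : M) : M :=
  Classical.epsilon fun x => (¬ ∃ z, z < y ∧ G x z) ∧ ∀ x', x' < x → ∃ z, z < y ∧ G x' z

variable [IsStrictOrderedRing M] [CanonicallyOrderedAdd M] (hM : ModelsRCA0Star 𝒳) {I : Set M}
include hM

theorem exists_enumeration (hI : IsCut I) (hproper : I ≠ Set.univ)
    (hdef : Sigma01Definable 𝒳 I) : ∃ G, Enumerates 𝒳 I G := by
  obtain ⟨φ, hφ⟩ := hdef
  have hφI : ∀ x, x ∈ I ↔ ∃ y, φ.Realize ![x, y] := fun x => by rw [hφ]; rfl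
  have hφ₀ : IsDelta0 𝒳 fun v : Fin 2 → M => φ.Realize ![v 0, v 1] :=
    ⟨φ, fun v => iff_of_eq (congrArg _ (List.ofFn_inj.1 rfl))⟩
  -- `W x y` holds when every `x' ≤ x` has a witness below `y`; unlike `φ`, it is monotone in `y`
  -- and antitone in `x`.
  let W : M → M → Prop := fun x y => ∀ x', x' < x + 1 → ∃ z, z < y ∧ φ.Realize ![x', z]
  have hW : IsDelta0 𝒳 fun v : Fin 2 → M => W (v 0) (v 1) := by
    refine .ball hM (.add hM (.proj 0) (.const 1))
      (P := fun v x' => ∃ z, z < v 1 ∧ φ.Realize ![x', z]) ?_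
    exact .bex hM (.proj 2) (P := fun v z => φ.Realize ![v 0, z]) (hφ₀.rename ![1, 0])
  have hWI : ∀ x, x ∈ I ↔ ∃ y, W x y := by
    refine fun x => ⟨fun hx => ?_, ?_⟩
    · exact hM.collect (R := fun x y => φ.Realize ![x, y]) hφ₀ (x + 1) fun x' hx' =>
        (hφI x').1 (hI.downward _ _ (hM.lt_add_one.1 hx') hx)
    · rintro ⟨y, hy⟩
      obtain ⟨z, -, hz⟩ := hy x (_root_.lt_add_one x)
      exact (hφI x).2 ⟨z, hz⟩
  have hW_anti : ∀ {x x' y}, x ≤ x' → W x' y → W x y := fun h hW z hz =>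
    hW z (hM.lt_add_one.2 ((hM.lt_add_one.1 hz).trans h))
  have hW_mono : ∀ {x y y'}, y ≤ y' → W x y → W x y' := fun h hW z hz =>
    (hW z hz).imp fun _ hu => ⟨hu.1.trans_le h, hu.2⟩
  -- If `b` bounded witnesses for all of `I`, then `W · b` would be `Δ⁰₀` and inductive, forcing `I
  -- = M`.
  have hcof : ∀ b, ∃ x ∈ I, ¬ W x b := by
    intro b
    by_contra! hc
    refine hproper (Set.eq_univ_of_forall fun x => ?_)
    refine (hWI x).2 ⟨b, ?_⟩
    refine hM.induct (P := fun x => W x b) (.comp₂ hM hW (.proj 0) (.const b))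
      (hc 0 hI.zero_mem) (fun x hx => hc _ (hI.succ_mem x ((hWI x).2 ⟨b, hx⟩))) x
  -- The least bound `u` is only weakly increasing in `x`; the summand `x` makes the map strictly
  -- increasing.
  let G : M → M → Prop := fun x y => ∃ u, u < y + 1 ∧ (y = u + x ∧ W x u ∧ ∀ z, z < u → ¬ W x z)
  have least_unique : ∀ {x u u'}, (W x u ∧ ∀ z, z < u → ¬ W x z) →
      (W x u' ∧ ∀ z, z < u' → ¬ W x z) → u = u' := fun h h' =>
    le_antisymm (not_lt.1 fun hlt => h.2 _ hlt h'.1) (not_lt.1 fun hlt => h'.2 _ hlt h.1)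
  have hG : ∀ x ∈ I, ∃ y, G x y := by
    intro x hx
    obtain ⟨u, hu⟩ := hM.exists_least (P := fun u => W x u)
      (.comp₂ hM hW (.const x) (.proj 0)) ((hWI x).1 hx)
    exact ⟨u + x, u, hM.lt_add_one.2 le_self_add, rfl, hu⟩
  refine ⟨G, ?_, fun x => ⟨hG x, ?_⟩, ?_, ?_, ?_⟩
  · refine .bex hM (.add hM (.proj 1) (.const 1))
      (P := fun v u => v 1 = u + v 0 ∧ W (v 0) u ∧ ∀ z, z < u → ¬ W (v 0) z) ?_
    refine .and (.eq hM (.proj 2) (.add hM (.proj 0) (.proj 1))) (.and (hW.rename ![1, 0]) ?_)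
    exact .ball hM (.proj 0) (P := fun v z => ¬ W (v 1) z) (.not (hW.rename ![2, 0]))
  · rintro ⟨y, u, -, -, h, -⟩
    exact (hWI x).2 ⟨u, h⟩
  · rintro x y y' ⟨u, -, rfl, h⟩ ⟨u', -, rfl, h'⟩
    rw [least_unique h h']
  · rintro x x' y y' hx ⟨u, -, rfl, h⟩ ⟨u', -, rfl, h'⟩
    exact add_lt_add_of_le_of_lt (not_lt.1 fun hlt => h.2 _ hlt (hW_anti hx.le h'.1)) hx
  · intro b
    obtain ⟨x, hx, hb⟩ := hcof b
    obtain ⟨y, hy⟩ := hG x hx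
    refine ⟨x, y, hy, ?_⟩
    obtain ⟨u, -, rfl, h⟩ := hy
    exact (not_lt.1 fun hlt => hb (hW_mono hlt.le h.1)).trans le_self_add

namespace Enumerates

variable {G : M → M → Prop} (hG : Enumerates 𝒳 I G)
include hG

omit hM [IsStrictOrderedRing M] [CanonicallyOrderedAdd M] in
theorem value_spec {x : M} (hx : x ∈ I) : G x (value G x) :=
  Classical.epsilon_spec ((hG.mem_iff x).1 hx)

omit hM [IsStrictOrderedRing M] [CanonicallyOrderedAdd M] in
theorem le_of_le {x x' y y' : M} (h : x ≤ x') (hx : G x y) (hx' : G x' y') : y ≤ y' := by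
  rcases h.eq_or_lt with rfl | h
  · exact (hG.unique _ _ _ hx hx').le
  · exact (hG.strictMono _ _ _ _ h hx hx').le

theorem index_spec (y : M) :
    (∀ z, G (index G y) z → y ≤ z) ∧ ∀ x, x < index G y → ∃ z, z < y ∧ G x z := by
  have h : ∃ x, (¬ ∃ z, z < y ∧ G x z) ∧ ∀ x', x' < x → ∃ z, z < y ∧ G x' z := by
    obtain ⟨x, hx, h⟩ := hM.exists_least (P := fun x => ¬ ∃ z, z < y ∧ G x z)
      (.not (.bex hM (.const y) (P := fun v z => G (v 0) z) (hG.delta0.rename ![1, 0]))) <| by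
        obtain ⟨x, z, hxz, hz⟩ := hG.cofinal y
        refine ⟨x, ?_⟩
        rintro ⟨z', hz', h⟩
        exact absurd hz' (not_lt.2 (hG.unique _ _ _ hxz h ▸ hz))
    exact ⟨x, hx, fun x' hx' => not_not.1 (h x' hx')⟩
  obtain ⟨h₁, h₂⟩ := Classical.epsilon_spec h
  exact ⟨fun z hz => not_lt.1 fun hlt => h₁ ⟨z, hlt, hz⟩, h₂⟩

theorem index_le {x y z : M} (hx : G x z) (hy : y ≤ z) : index G y ≤ x := by
  by_contra hlt
  obtain ⟨z', hz', h⟩ := (hG.index_spec hM y).2 x (not_le.1 hlt)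
  exact absurd (hy.trans (hG.unique _ _ _ hx h).le) (not_le.2 hz')

theorem index_mem (hI : IsCut I) (y : M) : index G y ∈ I := by
  obtain ⟨x, z, hx, hz⟩ := hG.cofinal y
  exact hI.downward _ _ (hG.index_le hM hx hz) ((hG.mem_iff x).2 ⟨z, hx⟩)

theorem lt_index (hI : IsCut I) {x y z : M} (hx : G x z) (hz : z < y) : x < index G y := by
  by_contra hle
  have h := hG.value_spec (hG.index_mem hM hI y)
  exact absurd (((hG.index_spec hM y).1 _ h).trans (hG.le_of_le (not_lt.1 hle) h hx)) (not_le.2 hz)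

theorem index_eq (hI : IsCut I) {x y : M} (h : G x y) : index G y = x := by
  refine le_antisymm (hG.index_le hM h le_rfl) (not_lt.1 fun hlt => ?_)
  have h' := hG.value_spec (hG.index_mem hM hI y)
  exact absurd ((hG.index_spec hM y).1 _ h') (not_le.2 (hG.strictMono _ _ _ _ hlt h' h))

theorem index_mono (hI : IsCut I) {y y' : M} (h : y ≤ y') : index G y ≤ index G y' := by
  have h' := hG.value_spec (hG.index_mem hM hI y')
  exact hG.index_le hM h' (h.trans ((hG.index_spec hM y').1 _ h'))

theorem isDelta0Fn_index {f : (Fin n → M) → M} (hf : IsDelta0Fn 𝒳 f) :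
    IsDelta0Fn 𝒳 fun v => index G (f v) := by
  refine .comp₁ hM (F := index G) ?_ hf
  have : IsDelta0 𝒳 fun v : Fin 2 → M => (¬ ∃ z, z < v 1 ∧ G (v 0) z) ∧
      ∀ x, x < v 0 → ∃ z, z < v 1 ∧ G x z :=
    .and (.not (.bex hM (.proj 1) (P := fun v z => G (v 0) z) (hG.delta0.rename ![1, 0])))
      (.ball hM (.proj 0) (P := fun v x => ∃ z, z < v 1 ∧ G x z)
        (.bex hM (.proj 2) (P := fun v z => G (v 0) z) (hG.delta0.rename ![1, 0])))
  refine this.congr fun v => ?_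
  change v 0 = index G (v 1) ↔ _
  have h := hG.index_spec hM (v 1)
  constructor
  · intro e
    rw [e]
    exact ⟨fun ⟨z, hz, hz'⟩ => absurd (h.1 z hz') (not_le.2 hz), h.2⟩
  · rintro ⟨h₁, h₂⟩
    refine le_antisymm (not_lt.1 fun hlt => ?_) (not_lt.1 fun hlt => h₁ (h.2 _ hlt))
    obtain ⟨z, hz, hz'⟩ := h₂ _ hlt
    exact absurd (h.1 z hz') (not_le.2 hz)

end Enumerates

end Enumeration

/-! ### Increasing tuples and graphs of colourings -/

section Colourings

variable {M : Type u} [LinearOrder M] {D : Set M} {n k : ℕ}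

/-- The element of `[D]ⁿ` given by an increasing tuple of elements of `D`. -/
def increasing (t : Fin n → M) (hD : ∀ i, t i ∈ D) (ht : StrictMono t) : Fin n ↪o D :=
  OrderEmbedding.ofStrictMono (fun i => ⟨t i, hD i⟩) fun _ _ h => ht h

theorem strictMono_coe (x : Fin n ↪o D) : StrictMono fun i => (x i : M) :=
  fun _ _ h => x.strictMono h

theorem embedding_ext {x y : Fin n ↪o D} (h : ∀ i, (x i : M) = y i) : x = y :=
  RelEmbedding.ext fun i => Subtype.ext (h i)

variable [CommSemiring M] {𝒳 : Set (Set M)}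

theorem mem_graph {f : (Fin n ↪o D) → Fin k} {t : Fin (n + 1) → M} :
    t ∈ graph f ↔ ∃ x : Fin n ↪o D, (∀ i, t i.castSucc = x i) ∧ t (Fin.last n) = (f x : ℕ) := by
  refine exists_congr fun x => ⟨?_, ?_⟩
  · rintro rfl
    simp
  · rintro ⟨h, h'⟩
    funext i
    cases i using Fin.lastCases <;> simp [h, h']

theorem snoc_mem_graph {f : (Fin n ↪o D) → Fin k} (x : Fin n ↪o D) :
    (Fin.snoc (α := fun _ => M) (fun i => (x i : M)) ((f x : ℕ) : M)) ∈ graph f := ⟨x, rfl⟩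

theorem graph_unique {f : (Fin n ↪o D) → Fin k} {t t' : Fin (n + 1) → M} (ht : t ∈ graph f)
    (ht' : t' ∈ graph f) (h : ∀ i : Fin n, t i.castSucc = t' i.castSucc) :
    t (Fin.last n) = t' (Fin.last n) := by
  obtain ⟨x, hx, e⟩ := mem_graph.1 ht
  obtain ⟨x', hx', e'⟩ := mem_graph.1 ht'
  obtain rfl : x = x' := embedding_ext fun i => by rw [← hx, ← hx', h]
  rw [e, e']

theorem IsCut.natCast_mem {I : Set M} (hI : IsCut I) : ∀ m : ℕ, (m : M) ∈ I
  | 0 => by simpa using hI.zero_mem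
  | m + 1 => by simpa using hI.succ_mem _ (hI.natCast_mem m)

theorem IsDelta0.strictMono [IsStrictOrderedRing M] [CanonicallyOrderedAdd M]
    (hM : ModelsRCA0Star 𝒳) {m : ℕ} {u : Fin n → (Fin m → M) → M}
    (hu : ∀ i, IsDelta0Fn 𝒳 (u i)) : IsDelta0 𝒳 fun v => StrictMono fun i => u i v :=
  .forall_fin fun i => .forall_fin fun j => .imp (.const (i < j)) (.lt hM (hu i) (hu j))

end Colourings

/-! ### Transfer of colourings and homogeneous sets between `M` and `I` -/

section Transfer

variable {M : Type u} [CommSemiring M] [LinearOrder M] [IsStrictOrderedRing M]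
  [CanonicallyOrderedAdd M] {𝒳 : Set (Set M)} (hM : ModelsRCA0Star 𝒳) {I : Set M} {n k : ℕ}
include hM

theorem relIn_iff {m : ℕ} {R : Set (Fin (m + 1) → M)} :
    R ∈ relIn 𝒳 (m + 1) ↔ {p | untuple (m + 1) p ∈ R} ∈ 𝒳 := by
  refine iff_of_eq (congrArg (· ∈ 𝒳) (Set.ext fun p => ?_))
  constructor
  · rintro ⟨x, hx, hp⟩
    rw [hM.isTupleCode_iff] at hp
    simpa [hp, hM.untuple_tupleCode] using hx
  · intro hp
    exact ⟨_, hp, hM.isTupleCode_iff.2 (hM.tupleCode_untuple m p).symm⟩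

theorem codRel_iff {m : ℕ} {R : Set (Fin m → M)} : R ∈ codRel I m ↔
    ∃ s, ∀ x, x ∈ R ↔ (∀ j, x j ∈ I) ∧ AckMem (tupleCode x) s := by
  refine exists_congr fun s => ?_
  rw [Set.ext_iff]
  refine forall_congr' fun x => ?_
  simp [hM.isTupleCode_iff]

variable {G : M → M → Prop} (hI : IsCut I) (hG : Enumerates 𝒳 I G)
include hI hG

/-- On tuples from `I`, having the right colour and having a wrong one are both `Σ⁰₁`: each is
witnessed by the image point in the graph of `f`. Separation then yields a code. -/
theorem coloring_pullback_mem (hproper : I ≠ Set.univ)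
    {f : (Fin n ↪o (Set.univ : Set M)) → Fin k} {f' : (Fin n ↪o I) → Fin k}
    (hf : graph f ∈ relIn 𝒳 (n + 1))
    (hff' : ∀ (x : Fin n ↪o I) (y : Fin n ↪o (Set.univ : Set M)),
      (∀ i, G (x i) (y i)) → f' x = f y) : graph f' ∈ codRel I (n + 1) := by
  obtain ⟨a, ha⟩ := (Set.ne_univ_iff_exists_notMem I).1 hproper
  rw [relIn_iff hM] at hf
  let u : M → Fin (n + 1) → M := fun p => untuple (n + 1) p
  let S : M → M → Prop := fun p q =>
    u q ∈ graph f ∧ ∀ i : Fin n, G (u p i.castSucc) (u q i.castSucc)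
  have hu : ∀ {m : ℕ} (i : Fin (n + 1)) (j : Fin m), IsDelta0Fn 𝒳 fun v => u (v j) i :=
    fun i j => .untuple hM i (.proj j)
  have hS : IsDelta0 𝒳 fun v : Fin 2 → M => S (v 0) (v 1) :=
    .and (.mem hM hf (.proj 1)) (.forall_fin fun i => .comp₂ hM hG.delta0 (hu _ 0) (hu _ 1))
  have hS_last : ∀ {p q q'}, S p q → S p q' → u q (Fin.last n) = u q' (Fin.last n) :=
    fun h h' => graph_unique h.1 h'.1 fun i => hG.unique _ _ _ (h.2 i) (h'.2 i)
  have hS_mono : ∀ {p q}, S p q → StrictMono fun i : Fin n => u p i.castSucc := by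
    intro p q h i j hij
    obtain ⟨y, hy, -⟩ := mem_graph.1 h.1
    by_contra hle
    have := hG.le_of_le (not_lt.1 hle) (h.2 j) (h.2 i)
    rw [hy, hy] at this
    exact absurd (strictMono_coe y hij) (not_lt.2 this)
  have hS_exists : ∀ {p} (x : Fin n ↪o I), (∀ i, u p i.castSucc = x i) →
      ∃ q, S p q ∧ u q (Fin.last n) = (f' x : ℕ) := by
    intro p x hx
    have hval : ∀ i, G (x i) (value G (x i)) := fun i => hG.value_spec (x i).2
    let y : Fin n ↪o (Set.univ : Set M) := increasing (fun i => value G (x i)) (fun _ => trivial)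
      fun i j hij => hG.strictMono _ _ _ _ (strictMono_coe x hij) (hval i) (hval j)
    refine ⟨tupleCode (Fin.snoc (α := fun _ => M) (fun i => (y i : M)) ((f y : ℕ) : M)), ?_, ?_⟩
    · simp only [S, u, hM.untuple_tupleCode]
      refine ⟨snoc_mem_graph y, fun i => ?_⟩
      rw [Fin.snoc_castSucc]
      change G (u p i.castSucc) _
      rw [hx i]
      exact hval i
    · simp [u, hM.untuple_tupleCode, hff' x y hval]
  -- The graph has to be separated also from tuples with non-increasing arguments, which have no
  -- image point. As `a ∉ I`, the code of the constant tuple `a` bounds all codes of tuples from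
  -- `I`.
  obtain ⟨s, hs⟩ := hM.exists_separation
    (P := fun p q => S p q ∧ u p (Fin.last n) = u q (Fin.last n))
    (Q := fun p q => (¬ StrictMono fun i : Fin n => u p i.castSucc) ∨
      (S p q ∧ u p (Fin.last n) ≠ u q (Fin.last n)))
    (.and hS (.eq hM (hu _ 0) (hu _ 1)))
    (.or (.not (.strictMono hM fun i => hu i.castSucc 0))
      (.and hS (.not (.eq hM (hu _ 0) (hu _ 1)))))
    (fun p q q' hP hQ => hQ.elim (fun h => h (hS_mono hP.1)) fun h =>
      h.2 (hP.2.trans (hS_last hP.1 h.1)))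
    (tupleCode (fun _ : Fin (n + 1) => a) + 1)
  refine (codRel_iff hM).2 ⟨s, fun t => ?_⟩
  have hut : u (tupleCode t) = t := hM.untuple_tupleCode t
  have hbound : (∀ j, t j ∈ I) → tupleCode t < tupleCode (fun _ : Fin (n + 1) => a) + 1 :=
    fun h => hM.lt_add_one.2 (hM.tupleCode_mono fun j =>
      (not_le.1 fun hle => ha (hI.downward _ _ hle (h j))).le)
  constructor
  · intro ht
    obtain ⟨x, hx, e⟩ := mem_graph.1 ht
    have htI : ∀ j, t j ∈ I := by
      intro j
      cases j using Fin.lastCases with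
      | last => exact e ▸ hI.natCast_mem _
      | cast i => exact hx i ▸ (x i).2
    obtain ⟨q, hq, hq'⟩ := hS_exists (p := tupleCode t) x (by rwa [hut])
    exact ⟨htI, (hs _ (hbound htI)).1 q ⟨hq, by rw [hut, e, hq']⟩⟩
  · rintro ⟨htI, hts⟩
    have hno : ∀ q, _ := fun q hq => (hs _ (hbound htI)).2 q hq hts
    have hmono : StrictMono fun i : Fin n => t i.castSucc := by
      by_contra h
      exact hno 0 (.inl (by rwa [hut]))
    let x : Fin n ↪o I := increasing _ (fun i => htI i.castSucc) hmono
    obtain ⟨q, hq, hq'⟩ := hS_exists (p := tupleCode t) x (by rw [hut]; exact fun _ => rfl)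
    refine mem_graph.2 ⟨x, fun _ => rfl, ?_⟩
    by_contra h
    exact hno q (.inr ⟨hq, by rwa [hut, hq']⟩)

theorem modelRT_of_cutRT (hproper : I ≠ Set.univ) (h : CutRT I n k) : ModelRT 𝒳 n k := by
  intro f hf
  have hval : ∀ x : Fin n ↪o I, ∀ i, G (x i) (value G (x i)) := fun x i => hG.value_spec (x i).2
  let push : (Fin n ↪o I) → (Fin n ↪o (Set.univ : Set M)) := fun x =>
    increasing (fun i => value G (x i)) (fun _ => trivial)
      fun i j hij => hG.strictMono _ _ _ _ (strictMono_coe x hij) (hval x i) (hval x j)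
  have push_eq : ∀ (x : Fin n ↪o I) (y : Fin n ↪o (Set.univ : Set M)),
      (∀ i, G (x i) (y i)) → push x = y :=
    fun x y hxy => embedding_ext fun i => hG.unique _ _ _ (hval x i) (hxy i)
  obtain ⟨H', ⟨s, rfl⟩, -, hunb, c, hc⟩ := h (fun x => f (push x))
    (coloring_pullback_mem hM hI hG hproper hf fun x y hxy => by rw [push_eq x y hxy])
  -- The homogeneous set is the image under `G` of the coded one; the condition `G (index G y) y`
  -- says that `y` is a value of `G`.
  refine ⟨{y | G (index G y) y ∧ AckMem (index G y) s}, ?_, Set.subset_univ _, ?_, c, ?_⟩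
  · have hidx := hG.isDelta0Fn_index hM (.proj (0 : Fin 1))
    exact IsDelta0.mem_model hM (P := fun y => G (index G y) y ∧ AckMem (index G y) s)
      (.and (.comp₂ hM hG.delta0 hidx (.proj 0)) (.ackMem hM hidx (.const s)))
  · intro b _
    obtain ⟨x, y, hxy, hb⟩ := hG.cofinal b
    obtain ⟨x', ⟨hx's, hx'I⟩, hx'⟩ := hunb x ((hG.mem_iff x).2 ⟨y, hxy⟩)
    have hy' := hG.value_spec hx'I
    refine ⟨value G x', ?_, hb.trans (hG.le_of_le hx' hxy hy')⟩
    rw [Set.mem_ofPred_eq, hG.index_eq hM hI hy']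
    exact ⟨hy', hx's⟩
  · intro y hy
    have hmono : StrictMono fun i => index G (y i) := by
      intro i j hij
      refine (hG.index_mono hM hI (strictMono_coe y hij).le).lt_of_ne fun e => ?_
      have := hG.unique _ _ _ (e ▸ (hy i).1) (hy j).1
      exact absurd this (strictMono_coe y hij).ne
    have := hc (increasing _ (fun i => hG.index_mem hM hI (y i)) hmono)
      fun i => ⟨(hy i).2, hG.index_mem hM hI (y i)⟩
    rwa [push_eq _ y fun i => (hy i).1] at this

theorem coloring_index_mem {f : (Fin n ↪o I) → Fin k}
    {f' : (Fin n ↪o (Set.univ : Set M)) → Fin k} (c : Fin k) (hf : graph f ∈ codRel I (n + 1))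
    (h₁ : ∀ (y : Fin n ↪o (Set.univ : Set M)) (x : Fin n ↪o I),
      (∀ i, index G (y i) = x i) → f' y = f x)
    (h₂ : ∀ y : Fin n ↪o (Set.univ : Set M), (¬ StrictMono fun i => index G (y i)) → f' y = c) :
    graph f' ∈ relIn 𝒳 (n + 1) := by
  obtain ⟨s, hs⟩ := (codRel_iff hM).1 hf
  rw [relIn_iff hM]
  let u : M → Fin (n + 1) → M := fun p => untuple (n + 1) p
  let w : M → Fin (n + 1) → M := fun p =>
    Fin.snoc (α := fun _ => M) (fun i => index G (u p i.castSucc)) (u p (Fin.last n))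
  have hu : ∀ i : Fin (n + 1), IsDelta0Fn 𝒳 fun v : Fin 1 → M => u (v 0) i :=
    fun i => .untuple hM i (.proj 0)
  have hidx : ∀ i : Fin n, IsDelta0Fn 𝒳 fun v : Fin 1 → M => index G (u (v 0) i.castSucc) :=
    fun i => hG.isDelta0Fn_index hM (hu _)
  have hw : ∀ i : Fin (n + 1), IsDelta0Fn 𝒳 fun v : Fin 1 → M => w (v 0) i := by
    intro i
    cases i using Fin.lastCases with
    | last => simpa [w] using hu (Fin.last n)
    | cast i => simpa [w] using hidx i
  have hinc : IsDelta0 𝒳 fun v : Fin 1 → M =>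
      StrictMono fun i : Fin n => index G (u (v 0) i.castSucc) := .strictMono hM hidx
  -- The code `s` is meaningful only on tuples from `I`. Indices lie in `I` automatically; the bound
  -- `k` on the last entry puts the colour there too.
  have := IsDelta0.mem_model hM (P := fun p => (StrictMono fun i : Fin n => u p i.castSucc) ∧
    ((StrictMono fun i : Fin n => index G (u p i.castSucc)) ∧ u p (Fin.last n) ≤ (k : M) ∧
        AckMem (tupleCode (w p)) s ∨
      (¬ StrictMono fun i : Fin n => index G (u p i.castSucc)) ∧ u p (Fin.last n) = (c : ℕ)))
    (.and (.strictMono hM fun i => hu i.castSucc)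
      (.or (.and hinc (.and (.le hM (hu _) (.const _))
        (.ackMem hM (.tupleCode hM hw) (.const s)))) (.and (.not hinc) (.eq hM (hu _) (.const _)))))
  refine iff_of_eq (congrArg (· ∈ 𝒳) (Set.ext fun p => ?_)) |>.1 this
  change _ ↔ u p ∈ graph f'
  rw [mem_graph]
  constructor
  · rintro ⟨hmono, h⟩
    refine ⟨increasing _ (fun _ => trivial) hmono, fun _ => rfl, ?_⟩
    rcases h with ⟨-, hle, hA⟩ | ⟨hnot, e⟩
    · have hwI : ∀ j, w p j ∈ I := by
        intro j
        cases j using Fin.lastCases with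
        | last => simpa [w] using hI.downward _ _ hle (hI.natCast_mem k)
        | cast i => simpa [w] using hG.index_mem hM hI _
      obtain ⟨x, hx, e⟩ := mem_graph.1 ((hs _).2 ⟨hwI, hA⟩)
      have hx' : ∀ i : Fin n, index G (u p i.castSucc) = x i := fun i => by simpa [w] using hx i
      rw [h₁ _ x hx']
      simpa [w] using e
    · rw [h₂ _ hnot, e]
  · rintro ⟨y, hy, e⟩
    refine ⟨?_, ?_⟩
    · simpa only [hy] using strictMono_coe y
    simp only [hy]
    by_cases hmono : StrictMono fun i => index G (y i)
    · refine .inl ⟨hmono, ?_, ?_⟩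
      · rw [e]
        exact Nat.cast_le.2 (f' y).2.le
      · let x : Fin n ↪o I := increasing _ (fun i => hG.index_mem hM hI (y i)) hmono
        refine ((hs _).1 (mem_graph.2 ⟨x, fun i => ?_, ?_⟩)).2
        · simp only [w, Fin.snoc_castSucc, hy]
          rfl
        · rw [← h₁ y x fun _ => rfl]
          simpa [w] using e
    · exact .inr ⟨hmono, by rw [e, h₂ y hmono]⟩

theorem cutRT_of_modelRT (hproper : I ≠ Set.univ) (h : ModelRT 𝒳 n k) : CutRT I n k := by
  classical
  obtain ⟨a, ha⟩ := (Set.ne_univ_iff_exists_notMem I).1 hproper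
  intro f hf
  -- Default colour for tuples whose indices are not strictly increasing. Taking the colour of `(0,
  -- …, n - 1)`, which lies in every cut, avoids assuming `k > 0`.
  let c₀ : Fin k := f (increasing (fun i => ((i : ℕ) : M)) (fun i => hI.natCast_mem i)
    fun i j hij => Nat.cast_lt.2 hij)
  let f' : (Fin n ↪o (Set.univ : Set M)) → Fin k := fun y =>
    if hy : StrictMono fun i => index G (y i) then
      f (increasing _ (fun i => hG.index_mem hM hI (y i)) hy) else c₀
  have hf' : ∀ (y : Fin n ↪o (Set.univ : Set M)) (x : Fin n ↪o I),
      (∀ i, index G (y i) = x i) → f' y = f x := by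
    intro y x hxy
    have hy : StrictMono fun i => index G (y i) := by simpa only [hxy] using strictMono_coe x
    simp only [f', dif_pos hy]
    exact congrArg f (embedding_ext hxy)
  obtain ⟨H, hH, -, hunb, c, hc⟩ := h f'
    (coloring_index_mem hM hI hG c₀ hf hf' fun y hy => dif_neg hy)
  -- The set of indices of elements of `H` is to be coded. Any `y` with index `x` satisfies `y ≤ G
  -- x`, so failure of `x` to be such an index can be checked by a search up to `G x`, and is `Σ⁰₁`
  -- as well.
  obtain ⟨s, hs⟩ := hM.exists_separation
    (P := fun x y => y ∈ H ∧ index G y = x)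
    (Q := fun x z => G x z ∧ ∀ y, y < z + 1 → y ∈ H → index G y ≠ x)
    (.and (.mem hM hH (.proj 1)) (.eq hM (hG.isDelta0Fn_index hM (.proj 1)) (.proj 0)))
    (.and hG.delta0 (.ball hM (.add hM (.proj 1) (.const 1))
      (P := fun v y => y ∈ H → index G y ≠ v 0)
      (.imp (.mem hM hH (.proj 0))
        (.not (.eq hM (hG.isDelta0Fn_index hM (.proj 0)) (.proj 1))))))
    (fun x y z hP hQ => hQ.2 y
      (hM.lt_add_one.2 ((hG.index_spec hM y).1 z (hP.2.symm ▸ hQ.1))) hP.1 hP.2) a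
  have hsI : ∀ x ∈ I, AckMem x s ↔ ∃ y ∈ H, index G y = x := by
    intro x hx
    have hxa : x < a := not_le.1 fun hle => ha (hI.downward _ _ hle hx)
    refine ⟨fun hxs => ?_, fun ⟨y, hy⟩ => (hs x hxa).1 y hy⟩
    by_contra! hno
    exact (hs x hxa).2 _ ⟨hG.value_spec hx, fun y _ hy => hno y hy⟩ hxs
  refine ⟨{x | AckMem x s} ∩ I, ⟨s, rfl⟩, Set.inter_subset_right, ?_, c, ?_⟩
  · intro x hx
    obtain ⟨y, hy, hle⟩ := hunb (value G x + 1) trivial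
    have hyI := hG.index_mem hM hI y
    refine ⟨index G y, ⟨(hsI _ hyI).2 ⟨y, hy, rfl⟩, hyI⟩, ?_⟩
    exact (hG.lt_index hM hI (hG.value_spec hx) ((_root_.lt_add_one _).trans_le hle)).le
  · intro x hx
    -- Lift the tuple to elements of `H` with the prescribed indices; since `index` is monotone, the
    -- lift is increasing and `f'` colours it as `f` colours `x`.
    choose y hyH hy using fun i => (hsI (x i) (x i).2).1 (hx i).1
    have hmono : StrictMono y := by
      intro i j hij
      by_contra hle
      have := hG.index_mono hM hI (not_lt.1 hle)
      rw [hy, hy] at this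
      exact absurd (strictMono_coe x hij) (not_lt.2 this)
    rw [← hf' (increasing y (fun _ => trivial) hmono) x hy]
    exact hc _ hyH

end Transfer

end Arith

theorem mainTheorem1 {M : Type u} [CommSemiring M] [LinearOrder M] [IsStrictOrderedRing M]
    [CanonicallyOrderedAdd M] (𝒳 : Set (Set M)) (hM : Arith.ModelsRCA0Star 𝒳)
    (I : Set M) (hI : Arith.IsCut I) (hproper : I ≠ Set.univ)
    (hdef : Arith.Sigma01Definable 𝒳 I) (n k : ℕ) :
    Arith.ModelRT 𝒳 n k ↔ Arith.CutRT I n k := by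
  obtain ⟨G, hG⟩ := Arith.exists_enumeration hM hI hproper hdef
  exact ⟨Arith.cutRT_of_modelRT hM hI hG hproper, Arith.modelRT_of_cutRT hM hI hG hproper⟩
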